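/- Let $p,q$ be odd primes with $q-p=2^m$, $m\ge 2$, and let $D=D_1\cdots D_n$ be a product of distinct odd primes $D_1,\dots,D_n$, none equal to $p$ or $q$; put $\widehat{D_i}=D/D_i$. Consider $$E=E_-:\ y^2=x(x-pD)(x-qD),\qquad E'=E'_-:\ y^2=x^3+2(p+q)Dx^2+4^mD^2x,$$ and the isogeny $\varphi:E\to E'$, $(x,y)\mapsto\left(\frac{y^2}{x^2},\frac{y(pqD^2-x^2)}{x^2}\right)$, with kernel $E[\varphi]=\{O,(0,0)\}$. Let $S^{(\varphi)}(E/\mathbb Q)\subset H^1(\mathbb Q,E[\varphi])\cong\mathbb Q^{\star}/\mathbb Q^{\star 2}$ be the $\varphi$-Selmer group, i.e. the group of classes which become trivial in $H^1(\mathbb Q_v,E)$ for every place $v$ of $\mathbb Q$ (including $\infty$). Write $\left(\frac{\cdot}{l}\right)$ for the Legendre symbol; in the sums below $l$ runs over the primes dividing the indicated number. Define, for $1\le i\le n$, $$\Pi_i^-(D)=\delta_i+\left(1-\left(\tfrac{-q\widehat{D_i}}{D_i}\right)\right)\left(1-\left(\tfrac{-p\widehat{D_i}}{D_i}\right)\right)+\sum_{l\mid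 pq\widehat{D_i}}\left(1-\left(\tfrac{D_i}{l}\right)\right),$$ where $\delta_i=0$ if $D_i\equiv1\pmod 4$, or $m=2$ and $p+D\equiv2\pmod 8$, or $m\ge3$ and $p\equiv D\pmod 4$, and $\delta_i=1$ otherwise; $$\Pi_{n+1}^-(D)=\delta_{n+1}+\sum_{l\mid pqD}\left(1-\left(\tfrac{2}{l}\right)\right),$$ where $\delta_{n+1}=0$ if $m=3$ and $pD\equiv1\pmod 8$, or $m=4$ and $pD\equiv-1\pmod 8$, or $m\ge5$, and $\delta_{n+1}=1$ otherwise; $$\Pi_{n+2}^-(D)=\delta_{n+2}+\sum_{l\mid pqD}\left(1-\left(\tfrac{-1}{l}\right)\right),$$ where $\delta_{n+2}=0$ if $pD\equiv1\pmod 8$, or $m\ge3$ and $pD\equiv5\pmod 8$, and $\delta_{n+2}=1$ otherwise. Put $$\rho^-(D)=\sum_{i=1}^{n+2}\left\lfloor\frac{1}{1+\Pi_i^-(D)}\right\rfloor .$$ Then there is a subset $T\subset\{-1,2,D_1,\dots,D_n\}$ with $\#T=\rho^-(D)$ such that the subgroup $\langle T\rangle$ of $\mathbb Q^{\star}/\mathbb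 Q^{\star 2}$ generated by the classes of the elements of $T$ is contained in $S^{(\varphi)}(E/\mathbb Q)$ and $\langle T\rangle\cong(\mathbb Z/2\mathbb Z)^{\rho^-(D)}$. In particular $\dim_2S^{(\varphi)}(E/\mathbb Q)\ge\rho^-(D)$. -/

import Mathlib

noncomputable section

namespace TwoDescent

open WeierstrassCurve
open scoped Classical

/-- The standing data: odd primes `p`, `q` with `q - p = 2 ^ m`, `m ≥ 1`, and distinct odd primes
`D₁, …, Dₙ`, all different from `p` and `q`. -/
structure Data (n : ℕ) where
  /-- the odd prime `p` -/
  p : ℕ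
  /-- the odd prime `q` -/
  q : ℕ
  /-- the exponent in `q - p = 2 ^ m` -/
  m : ℕ
  /-- the primes `D₁, …, Dₙ` -/
  Di : Fin n → ℕ
  p_prime : p.Prime
  q_prime : q.Prime
  p_odd : Odd p
  q_odd : Odd q
  one_le_m : 1 ≤ m
  q_eq : q = p + 2 ^ m
  Di_prime : ∀ i, (Di i).Prime
  Di_odd : ∀ i, Odd (Di i)
  Di_ne_p : ∀ i, Di i ≠ p
  Di_ne_q : ∀ i, Di i ≠ q
  Di_inj : Function.Injective Di

variable {n : ℕ} (S : Data n)

namespace Data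

/-- `D = D₁ ⋯ Dₙ`. -/
def D : ℕ := ∏ i, S.Di i

/-- `D / Dᵢ`, the product of the other primes. -/
def Dhat (i : Fin n) : ℕ := ∏ j ∈ Finset.univ.erase i, S.Di j

lemma D_pos : 0 < S.D := Finset.prod_pos fun i _ => (S.Di_prime i).pos

/-! ### The elliptic curves and the isogeny -/

/-- The curve `E_ε : y² = x (x + ε p D) (x + ε q D)`. -/
def E (ε : ℤˣ) : WeierstrassCurve ℚ where
  a₁ := 0
  a₂ := (ε : ℤ) * S.p * S.D + (ε : ℤ) * S.q * S.D
  a₃ := 0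
  a₄ := ((ε : ℤ) * S.p * S.D) * ((ε : ℤ) * S.q * S.D)
  a₆ := 0

/-- The curve `E'_ε : y² = x³ - 2 ε (p + q) D x² + 4 ^ m D² x`. -/
def E' (ε : ℤˣ) : WeierstrassCurve ℚ where
  a₁ := 0
  a₂ := -2 * (ε : ℤ) * (S.p + S.q) * S.D
  a₃ := 0
  a₄ := 4 ^ S.m * S.D ^ 2
  a₆ := 0

lemma eps_sq (ε : ℤˣ) : (((ε : ℤ) : ℚ)) ^ 2 = 1 := by
  rcases Int.units_eq_one_or ε with rfl | rfl <;> norm_num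

lemma p_ne : (S.p : ℚ) ≠ 0 := by exact_mod_cast S.p_prime.ne_zero
lemma q_ne : (S.q : ℚ) ≠ 0 := by exact_mod_cast S.q_prime.ne_zero
lemma D_ne : (S.D : ℚ) ≠ 0 := by exact_mod_cast S.D_pos.ne'
lemma q_cast : (S.q : ℚ) = S.p + 2 ^ S.m := by exact_mod_cast S.q_eq

lemma four_pow : (4 : ℚ) ^ S.m = (S.q - S.p) ^ 2 := by
  rw [q_cast, add_sub_cancel_left, ← pow_mul, mul_comm, pow_mul]; norm_num

lemma sub_ne : (S.q : ℚ) - S.p ≠ 0 := by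
  rw [q_cast, add_sub_cancel_left]; positivity

lemma E_Δ_ne (ε : ℤˣ) : (S.E ε).Δ ≠ 0 := by
  have h : (S.E ε).Δ
      = 16 * (((ε : ℤ) : ℚ) ^ 2) ^ 3 * (S.p * S.q) ^ 2 * (S.q - S.p) ^ 2 * S.D ^ 6 := by
    simp only [E, Δ, b₂, b₄, b₆, b₈]; ring
  rw [h, eps_sq]
  have := S.p_ne; have := S.q_ne; have := S.D_ne; have := S.sub_ne
  positivity

lemma E'_Δ_ne (ε : ℤˣ) : (S.E' ε).Δ ≠ 0 := by
  have h : (S.E' ε).Δ = 16 * (4 ^ S.m) ^ 2 * S.D ^ 6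
      * (4 * ((ε : ℤ) : ℚ) ^ 2 * (S.p + S.q) ^ 2 - 4 * 4 ^ S.m) := by
    simp only [E', Δ, b₂, b₄, b₆, b₈]; ring
  have h2 : (4 * ((ε : ℤ) : ℚ) ^ 2 * (S.p + S.q) ^ 2 - 4 * 4 ^ S.m) = 16 * S.p * S.q := by
    rw [eps_sq, four_pow]; ring
  rw [h, h2]
  have := S.p_ne; have := S.q_ne; have := S.D_ne
  positivity

section Isogeny

variable (ε : ℤˣ) (F : Type*) [Field F] [Algebra ℚ F]

lemma E_equation {x y : F} : ((S.E ε)⁄F).toAffine.Equation x y ↔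
    y ^ 2 = x * (x + (ε : ℤ) * S.p * S.D) * (x + (ε : ℤ) * S.q * S.D) := by
  rw [Affine.equation_iff]
  simp only [E, WeierstrassCurve.baseChange, WeierstrassCurve.map, WeierstrassCurve.toAffine]
  simp only [map_zero, map_add, map_mul, map_natCast, map_intCast]
  constructor <;> intro h <;> linear_combination h

lemma E'_equation {x y : F} : ((S.E' ε)⁄F).toAffine.Equation x y ↔
    y ^ 2 = x ^ 3 - 2 * (ε : ℤ) * (S.p + S.q) * S.D * x ^ 2 + 4 ^ S.m * S.D ^ 2 * x := by
  rw [Affine.equation_iff]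
  simp only [E', WeierstrassCurve.baseChange, WeierstrassCurve.map, WeierstrassCurve.toAffine]
  simp only [map_zero, map_add, map_mul, map_neg, map_pow, map_natCast, map_intCast, map_ofNat]
  constructor <;> intro h <;> linear_combination h

lemma E_nonsingular {x y : F} (h : ((S.E ε)⁄F).toAffine.Equation x y) :
    ((S.E ε)⁄F).toAffine.Nonsingular x y := by
  refine (Affine.equation_iff_nonsingular_of_Δ_ne_zero ?_).mp h
  rw [WeierstrassCurve.toAffine, WeierstrassCurve.baseChange, WeierstrassCurve.map_Δ]
  exact (map_ne_zero _).mpr (S.E_Δ_ne ε)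

lemma E'_nonsingular {x y : F} (h : ((S.E' ε)⁄F).toAffine.Equation x y) :
    ((S.E' ε)⁄F).toAffine.Nonsingular x y := by
  refine (Affine.equation_iff_nonsingular_of_Δ_ne_zero ?_).mp h
  rw [WeierstrassCurve.toAffine, WeierstrassCurve.baseChange, WeierstrassCurve.map_Δ]
  exact (map_ne_zero _).mpr (S.E'_Δ_ne ε)

lemma phi_equation {x y : F} (hx : x ≠ 0) (h : ((S.E ε)⁄F).toAffine.Equation x y) :
    ((S.E' ε)⁄F).toAffine.Equation (y ^ 2 / x ^ 2)
      (y * (S.p * S.q * S.D ^ 2 - x ^ 2) / x ^ 2) := by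
  rw [E_equation] at h
  rw [E'_equation]
  have e2 : (((ε : ℤ) : F)) ^ 2 = 1 := by
    rcases Int.units_eq_one_or ε with rfl | rfl <;> norm_num
  have h4 : (4 : F) ^ S.m = (S.q - S.p) ^ 2 := by
    have := congrArg (algebraMap ℚ F) S.four_pow
    simpa only [map_pow, map_sub, map_natCast, map_ofNat] using this
  rw [h4]
  have e2' : ((ε : ℤ) : F) * ((ε : ℤ) : F) = 1 := by rw [← sq]; exact e2
  have hX : y ^ 2 / x ^ 2 = x + (ε : ℤ) * (S.p + S.q) * S.D + S.p * S.q * S.D ^ 2 / x := by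
    rw [h]; field_simp; linear_combination (S.p * S.q * S.D ^ 2 : F) * e2'
  have hY : (y * (S.p * S.q * S.D ^ 2 - x ^ 2) / x ^ 2) ^ 2
      = (y ^ 2 / x ^ 2) * (S.p * S.q * S.D ^ 2 / x - x) ^ 2 := by
    field_simp
  have hb : S.p * S.q * S.D ^ 2 / x * x = (S.p * S.q * S.D ^ 2 : F) := div_mul_cancel₀ _ hx
  rw [hY, hX]
  generalize (S.p * S.q * S.D ^ 2 : F) / x = w at *
  linear_combination (x + (ε : ℤ) * (S.p + S.q) * S.D + w) * (S.D ^ 2 * (S.p + S.q) ^ 2 * e2' - 4 * hb)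

/-- The isogeny `φ : E → E'`, `(x, y) ↦ (y² / x², y (p q D² - x²) / x²)`, sending `O` and
`(0, 0)` to `O`, on points over a field `F`. -/
def phi : ((S.E ε)⁄F).toAffine.Point → ((S.E' ε)⁄F).toAffine.Point
  | .zero => .zero
  | .some x y h =>
    if hx : x = 0 then .zero
    else .some (y ^ 2 / x ^ 2) (y * (S.p * S.q * S.D ^ 2 - x ^ 2) / x ^ 2)
      (S.E'_nonsingular ε F (S.phi_equation ε F hx h.1))

/-- The point `(0, 0)` of `E`. -/
def T₀ : ((S.E ε)⁄F).toAffine.Point :=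
  .some 0 0 (S.E_nonsingular ε F ((S.E_equation ε F).mpr (by ring)))

lemma phi_eq_zero_iff (P : ((S.E ε)⁄F).toAffine.Point) :
    S.phi ε F P = .zero ↔ P = .zero ∨ P = S.T₀ ε F := by
  rcases P with _ | ⟨x, y, h⟩
  · simp [phi]
  · by_cases hx : x = 0
    · subst hx
      have hy : y = 0 := by
        have := (S.E_equation ε F).mp h.1
        simpa using this
      subst hy
      simp [phi, T₀]
    · simp [phi, T₀, hx]

lemma neg_T₀ : -S.T₀ ε F = S.T₀ ε F := by
  simp only [T₀, Affine.Point.neg_some, Affine.Point.some.injEq, true_and]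
  simp only [Affine.negY, E, WeierstrassCurve.baseChange, WeierstrassCurve.map,
    WeierstrassCurve.toAffine, map_zero]
  ring

lemma T₀_add_T₀ : S.T₀ ε F + S.T₀ ε F = 0 := by
  nth_rewrite 1 [← S.neg_T₀ ε F]
  exact neg_add_cancel _

/-- The group `E[φ]`, the kernel of `φ`, inside the group of points of `E` over `F`. -/
def kerPhi : AddSubgroup ((S.E ε)⁄F).toAffine.Point where
  carrier := {P | S.phi ε F P = .zero}
  zero_mem' := rfl
  add_mem' := by
    intro P Q hP hQ
    simp only [Set.mem_ofPred_eq, phi_eq_zero_iff] at hP hQ ⊢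
    simp only [← Affine.Point.zero_def] at *
    rcases hP with rfl | rfl <;> rcases hQ with rfl | rfl <;> simp [T₀_add_T₀]
  neg_mem' := by
    intro P hP
    simp only [Set.mem_ofPred_eq, phi_eq_zero_iff] at hP ⊢
    simp only [← Affine.Point.zero_def] at *
    rcases hP with rfl | rfl <;> simp [neg_T₀]

lemma mem_kerPhi {P : ((S.E ε)⁄F).toAffine.Point} :
    P ∈ S.kerPhi ε F ↔ P = 0 ∨ P = S.T₀ ε F :=
  S.phi_eq_zero_iff ε F P

end Isogeny

end Data

section Cohomology

/-! ### Galois cohomology of points -/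

/-- An algebraic closure of `ℚ`. -/
abbrev Qbar : Type := AlgebraicClosure ℚ

instance : Algebra.IsAlgebraic ℚ Qbar := AlgebraicClosure.isAlgebraic ℚ

instance : IsAlgClosure ℚ Qbar := ⟨inferInstance, inferInstance⟩

instance : IsGalois ℚ Qbar where
  to_normal := IsAlgClosure.normal ℚ Qbar

/-- The absolute Galois group of `ℚ`, with its Krull topology. -/
abbrev GQ : Type := Qbar ≃ₐ[ℚ] Qbar

variable (W : WeierstrassCurve ℚ)

/-- The action of an automorphism of an extension `L` of `K` on the points of `W` over `L`. -/
def galAct {K L : Type*} [Field K] [Field L] [Algebra ℚ K] [Algebra ℚ L] [Algebra K L]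
    [IsScalarTower ℚ K L] (σ : L ≃ₐ[K] L) : (W⁄L).toAffine.Point →+ (W⁄L).toAffine.Point :=
  Affine.Point.map (W' := W) (σ : L →ₐ[K] L)

variable {W}

/-- The group `Z¹(ℚ, M)` of continuous (i.e. locally constant) 1-cocycles of the absolute Galois
group of `ℚ` with values in a group `M` of points of `W` over an algebraic closure of `ℚ`. -/
def cocycles (M : AddSubgroup (W⁄Qbar).toAffine.Point) :
    AddSubgroup (GQ → (W⁄Qbar).toAffine.Point) where
  carrier := {f | IsLocallyConstant f ∧ (∀ σ, f σ ∈ M) ∧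
    ∀ σ τ, f (σ * τ) = f σ + galAct W σ (f τ)}
  zero_mem' := ⟨IsLocallyConstant.const 0, fun _ => M.zero_mem, fun σ τ => by simp⟩
  add_mem' := by
    rintro f g ⟨hf, hf', hf''⟩ ⟨hg, hg', hg''⟩
    refine ⟨hf.add hg, fun σ => M.add_mem (hf' σ) (hg' σ), fun σ τ => ?_⟩
    simp only [Pi.add_apply, hf'', hg'', map_add]; abel
  neg_mem' := by
    rintro f ⟨hf, hf', hf''⟩
    refine ⟨hf.neg, fun σ => M.neg_mem (hf' σ), fun σ τ => ?_⟩
    simp only [Pi.neg_apply, hf'', map_neg]; abel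

/-- The group `B¹(ℚ, M)` of 1-coboundaries `σ ↦ σ P - P` with `P` in `M`. -/
def coboundaries (M : AddSubgroup (W⁄Qbar).toAffine.Point) :
    AddSubgroup (GQ → (W⁄Qbar).toAffine.Point) where
  carrier := {f | ∃ P ∈ M, ∀ σ, f σ = galAct W σ P - P}
  zero_mem' := ⟨0, M.zero_mem, fun σ => by simp⟩
  add_mem' := by
    rintro f g ⟨P, hP, hf⟩ ⟨Q, hQ, hg⟩
    refine ⟨P + Q, M.add_mem hP hQ, fun σ => ?_⟩
    simp only [Pi.add_apply, hf, hg, map_add]; abel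
  neg_mem' := by
    rintro f ⟨P, hP, hf⟩
    refine ⟨-P, M.neg_mem hP, fun σ => ?_⟩
    simp only [Pi.neg_apply, hf, map_neg]; abel

/-- The Galois cohomology group `H¹(ℚ, M)`. -/
def H1 (M : AddSubgroup (W⁄Qbar).toAffine.Point) : Type :=
  cocycles M ⧸ (coboundaries M).addSubgroupOf (cocycles M)

instance (M : AddSubgroup (W⁄Qbar).toAffine.Point) : AddCommGroup (H1 M) :=
  inferInstanceAs (AddCommGroup (cocycles M ⧸ (coboundaries M).addSubgroupOf (cocycles M)))

/-- The cohomology class of a cocycle. -/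
def H1.mk (M : AddSubgroup (W⁄Qbar).toAffine.Point) : cocycles M →+ H1 M :=
  QuotientAddGroup.mk' ((coboundaries M).addSubgroupOf (cocycles M))

lemma H1.mk_surjective (M : AddSubgroup (W⁄Qbar).toAffine.Point) :
    Function.Surjective (H1.mk M) :=
  QuotientAddGroup.mk'_surjective _

/-- The cocycles whose class becomes trivial in `H¹(K, W)`, the first cohomology of the absolute
Galois group of an extension `K` of `ℚ` with values in all points of `W` over the algebraic closure
of `K`. For an embedding `ι` of the closures, an automorphism `σ` of the closure of `K` restricts
to the automorphism `τ` of the closure of `ℚ` with `ι ∘ τ = σ ∘ ι`. -/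
def locallyTrivial (M : AddSubgroup (W⁄Qbar).toAffine.Point) (K : Type) [Field K] [Algebra ℚ K] :
    AddSubgroup (cocycles M) where
  carrier := {f | ∀ ι : Qbar →ₐ[ℚ] AlgebraicClosure K, ∃ P : (W⁄(AlgebraicClosure K)).toAffine.Point,
    ∀ (σ : AlgebraicClosure K ≃ₐ[K] AlgebraicClosure K) (τ : GQ), (∀ x, ι (τ x) = σ (ι x)) →
      Affine.Point.map (W' := W) ι (f.1 τ) = galAct W σ P - P}
  zero_mem' := fun ι => ⟨0, fun σ τ _ => by simp⟩
  add_mem' := by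
    intro f g hf hg ι
    obtain ⟨P, hP⟩ := hf ι
    obtain ⟨Q, hQ⟩ := hg ι
    refine ⟨P + Q, fun σ τ h => ?_⟩
    simp only [AddSubgroup.coe_add, Pi.add_apply, map_add, hP σ τ h, hQ σ τ h]; abel
  neg_mem' := by
    intro f hf ι
    obtain ⟨P, hP⟩ := hf ι
    refine ⟨-P, fun σ τ h => ?_⟩
    simp only [AddSubgroup.coe_neg, Pi.neg_apply, map_neg, hP σ τ h]; abel

/-- The Selmer group: the classes in `H¹(ℚ, M)` that become trivial in `H¹(ℚ_v, W)` for every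
place `v` of `ℚ`. -/
def selmer (M : AddSubgroup (W⁄Qbar).toAffine.Point) : AddSubgroup (H1 M) :=
  (locallyTrivial M ℝ ⊓ ⨅ (ℓ : ℕ) (_ : Fact ℓ.Prime), locallyTrivial M ℚ_[ℓ]).map (H1.mk M)

end Cohomology

namespace Data

variable (ε : ℤˣ)

/-- The `φ`-Selmer group `S^(φ)(E/ℚ)` as a subgroup of `H¹(ℚ, E[φ])`. -/
def selmerPhi : AddSubgroup (H1 (S.kerPhi ε Qbar)) := selmer (S.kerPhi ε Qbar)

lemma two_nsmul_H1 (x : H1 (S.kerPhi ε Qbar)) : 2 • x = 0 := by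
  obtain ⟨f, rfl⟩ := H1.mk_surjective _ x
  have h : 2 • f = 0 := by
    ext σ
    have := (S.mem_kerPhi ε Qbar).mp (f.2.2.1 σ)
    rw [two_nsmul]
    change f.1 σ + f.1 σ = 0
    rcases this with h | h <;> rw [h]
    · exact add_zero _
    · exact S.T₀_add_T₀ ε Qbar
  rw [← map_nsmul, h, map_zero]

instance : Module (ZMod 2) (S.selmerPhi ε) :=
  AddCommGroup.zmodModule fun x => Subtype.ext (S.two_nsmul_H1 ε x)

/-- A square root of `d` in the algebraic closure of `ℚ`. -/
def sqrtBar (d : ℚˣ) : Qbar :=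
  Classical.choose (IsAlgClosed.exists_pow_nat_eq (algebraMap ℚ Qbar d) two_pos)

lemma sqrtBar_sq (d : ℚˣ) : sqrtBar d ^ 2 = algebraMap ℚ Qbar d :=
  Classical.choose_spec (IsAlgClosed.exists_pow_nat_eq (algebraMap ℚ Qbar d) two_pos)

/-- The Kummer cocycle of `d`: `σ ↦ O` if `σ` fixes `√d`, and `σ ↦ (0, 0)` if `σ √d = -√d`. -/
def kummerFun (d : ℚˣ) (σ : GQ) : ((S.E ε)⁄Qbar).toAffine.Point :=
  if σ (sqrtBar d) = sqrtBar d then 0 else S.T₀ ε Qbar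

lemma apply_sqrtBar (d : ℚˣ) (σ : GQ) :
    σ (sqrtBar d) = sqrtBar d ∨ σ (sqrtBar d) = -sqrtBar d := by
  rw [← sq_eq_sq_iff_eq_or_eq_neg, ← map_pow, sqrtBar_sq, AlgEquiv.commutes]

lemma sqrtBar_ne (d : ℚˣ) : sqrtBar d ≠ 0 := by
  intro h
  have := sqrtBar_sq d
  rw [h, zero_pow two_ne_zero, eq_comm, map_eq_zero] at this
  exact d.ne_zero this

lemma neg_sqrtBar_ne (d : ℚˣ) : -sqrtBar d ≠ sqrtBar d := fun h =>
  sqrtBar_ne d (self_eq_neg.mp h.symm)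

lemma galAct_T₀ (σ : GQ) : galAct (S.E ε) σ (S.T₀ ε Qbar) = S.T₀ ε Qbar := by
  simp [galAct, T₀, Affine.Point.map_some]

lemma kummerFun_locConst (d : ℚˣ) : IsLocallyConstant (S.kummerFun ε d) := by
  refine (IsLocallyConstant.iff_exists_open _).mpr fun σ =>
    ⟨(fun τ => σ⁻¹ * τ) ⁻¹' (MulAction.stabilizer GQ (sqrtBar d) : Set GQ),
      (stabilizer_isOpen_of_isIntegral (sqrtBar d)).preimage (continuous_const_mul σ⁻¹),
      by simp, fun τ hτ => ?_⟩
  have h : σ⁻¹ (τ (sqrtBar d)) = sqrtBar d := hτ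
  have h' : τ (sqrtBar d) = σ (sqrtBar d) := by
    have := congrArg σ h
    rwa [← AlgEquiv.mul_apply, mul_inv_cancel, AlgEquiv.one_apply] at this
  simp only [kummerFun, h']

lemma kummerFun_mem (d : ℚˣ) : S.kummerFun ε d ∈ cocycles (S.kerPhi ε Qbar) := by
  refine ⟨S.kummerFun_locConst ε d, fun σ => ?_, fun σ τ => ?_⟩
  · rw [mem_kerPhi, kummerFun]
    split_ifs <;> simp
  · have hn := neg_sqrtBar_ne d
    have hT := S.T₀_add_T₀ ε Qbar
    simp only [kummerFun, AlgEquiv.mul_apply]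
    rcases apply_sqrtBar d σ with h | h <;> rcases apply_sqrtBar d τ with h' | h' <;>
      simp [h, h', hn, galAct_T₀, hT]

/-- The Kummer cocycle does not depend on the choice of the square root. -/
lemma kummerFun_eq (d : ℚˣ) (r : Qbar) (hr : r ^ 2 = algebraMap ℚ Qbar d) (σ : GQ) :
    S.kummerFun ε d σ = if σ r = r then 0 else S.T₀ ε Qbar := by
  have : r = sqrtBar d ∨ r = -sqrtBar d := by
    rw [← sq_eq_sq_iff_eq_or_eq_neg, hr, sqrtBar_sq]
  rcases this with rfl | rfl <;> simp [kummerFun]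

lemma kummerFun_mul (d d' : ℚˣ) :
    S.kummerFun ε (d * d') = S.kummerFun ε d + S.kummerFun ε d' := by
  funext σ
  have hT := S.T₀_add_T₀ ε Qbar
  have hn := neg_sqrtBar_ne d
  have hn' := neg_sqrtBar_ne d'
  rw [S.kummerFun_eq ε (d * d') (sqrtBar d * sqrtBar d')
    (by rw [mul_pow, sqrtBar_sq, sqrtBar_sq, Units.val_mul, map_mul])]
  have hnn : -(sqrtBar d * sqrtBar d') ≠ sqrtBar d * sqrtBar d' := fun h =>
    mul_ne_zero (sqrtBar_ne d) (sqrtBar_ne d') (self_eq_neg.mp h.symm)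
  simp only [Pi.add_apply, kummerFun, map_mul]
  rcases apply_sqrtBar d σ with h | h <;> rcases apply_sqrtBar d' σ with h' | h' <;>
    simp [h, h', hn, hn', hT, hnn]

lemma kummerFun_sq (d : ℚˣ) : S.kummerFun ε (d ^ 2) = 0 := by
  funext σ
  rw [S.kummerFun_eq ε (d ^ 2) (algebraMap ℚ Qbar d) (by simp)]
  simp

/-- The group `ℚ* / ℚ*²`. -/
abbrev SqClass : Type := ℚˣ ⧸ (powMonoidHom 2 : ℚˣ →* ℚˣ).range

/-- The class in `H¹(ℚ, E[φ])` of the Kummer cocycle, as a homomorphism on `ℚ*`. -/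
def kummerHom : ℚˣ →* Multiplicative (H1 (S.kerPhi ε Qbar)) :=
  MonoidHom.mk' (fun d => Multiplicative.ofAdd
      (H1.mk (S.kerPhi ε Qbar) ⟨S.kummerFun ε d, S.kummerFun_mem ε d⟩))
    fun d d' => by
      rw [← ofAdd_add, ← map_add]
      congr 2
      exact Subtype.ext (S.kummerFun_mul ε d d')

/-- The Kummer isomorphism `ℚ* / ℚ*² → H¹(ℚ, E[φ])`, induced by `E[φ] = {O, (0, 0)} ≅ {1, -1}`. -/
def kummer : SqClass →* Multiplicative (H1 (S.kerPhi ε Qbar)) :=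
  QuotientGroup.lift _ (S.kummerHom ε) (by
    rintro _ ⟨d, rfl⟩
    have h : (⟨S.kummerFun ε (d ^ 2), S.kummerFun_mem ε (d ^ 2)⟩ :
        cocycles (S.kerPhi ε Qbar)) = 0 := Subtype.ext (S.kummerFun_sq ε d)
    rw [MonoidHom.mem_ker, powMonoidHom_apply, kummerHom, MonoidHom.mk'_apply, h, map_zero,
      ofAdd_zero])

/-- The `φ`-Selmer group `S^(φ)(E/ℚ)` as a subgroup of `ℚ* / ℚ*²`. -/
def selmerPhiSq : Subgroup SqClass := (AddSubgroup.toSubgroup (S.selmerPhi ε)).comap (S.kummer ε)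

/-! ### The function `ρ⁻` -/

open scoped NumberTheorySymbols

/-- `Πᵢ⁻(D)` for `1 ≤ i ≤ n`. -/
def PiD (i : Fin n) : ℤ :=
  (if S.Di i ≡ 1 [MOD 4] ∨ (S.m = 2 ∧ S.p + S.D ≡ 2 [MOD 8]) ∨ (3 ≤ S.m ∧ S.p ≡ S.D [MOD 4])
    then 0 else 1)
  + (1 - J(-(S.q * S.Dhat i : ℤ) | S.Di i)) * (1 - J(-(S.p * S.Dhat i : ℤ) | S.Di i))
  + ∑ l ∈ (S.p * S.q * S.Dhat i).primeFactors, (1 - J((S.Di i : ℤ) | l))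

/-- `Πₙ₊₁⁻(D)`. -/
def PiTwo : ℤ :=
  (if (S.m = 3 ∧ S.p * S.D ≡ 1 [MOD 8]) ∨ (S.m = 4 ∧ (S.p * S.D : ℤ) ≡ -1 [ZMOD 8]) ∨ 5 ≤ S.m
    then 0 else 1)
  + ∑ l ∈ (S.p * S.q * S.D).primeFactors, (1 - J(2 | l))

/-- `Πₙ₊₂⁻(D)`. -/
def PiNegOne : ℤ :=
  (if S.p * S.D ≡ 1 [MOD 8] ∨ (3 ≤ S.m ∧ S.p * S.D ≡ 5 [MOD 8]) then 0 else 1)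
  + ∑ l ∈ (S.p * S.q * S.D).primeFactors, (1 - J(-1 | l))

/-- `ρ⁻(D)`, the sum of the `⌊1 / (1 + Π)⌋`; the natural-number floor is the usual one here,
since every `Π` is nonnegative. -/
def rhoMinus : ℕ :=
  ∑ i, ⌊(1 : ℚ) / (1 + S.PiD i)⌋₊ + ⌊(1 : ℚ) / (1 + S.PiTwo)⌋₊ + ⌊(1 : ℚ) / (1 + S.PiNegOne)⌋₊

/-- The prime `Dᵢ` as an element of `ℚ*`. -/
def DiUnit (i : Fin n) : ℚˣ :=
  Units.mk0 (S.Di i : ℚ) (by exact_mod_cast (S.Di_prime i).ne_zero)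

end Data

end TwoDescent

end

/-! ### Two-coverings and locally trivial Kummer classes -/

noncomputable section

namespace TwoDescent.Data

open WeierstrassCurve
open scoped Classical

variable {n : ℕ} (S : Data n)

/-! A class `d` is locally trivial over `K` as soon as its two-covering `d w² = (d u² + (p+q)D)² -
4pqD²` has a `K`-point. Such a point yields `P = (x, s x)` on `E₋` with `s = u√d` and `x` a root of
`X² - (s² + (p+q)D) X + pqD²`, whose discriminant is `d w²`. The conjugation `√d ↦ -√d` negates `s`
and swaps the two roots, and this is translation by `(0, 0)`. Hence `σP - P` is the Kummer cocycle
(`kummer_mem_locallyTrivial`).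

Each summand of `ρ⁻` is 1 exactly when its `Π` vanishes, and then the matching `d` among `-1`, `2`,
`Dᵢ` passes every local test. At odd primes away from `pqDd` the covering always has a point
(`coverSolvable_of_good`). At the other odd primes `d` is a square by the Legendre conditions,
except at `Dᵢ` for `d = Dᵢ`; there quadratic reciprocity makes both `-p D/Dᵢ` and `-q D/Dᵢ` squares,
which gives a point with `w = 0`. At `2` the conditions on `δ` are what Hensel's lemma needs, mostly
through `coverSolvable_two_of_mod_eight`.

The sign and the valuations modulo 2 separate the generators (`linearIndependent_gen`), and the
Kummer map is injective (`kummer_injective`), so the classes found span a space of dimension `ρ⁻`,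
both in `ℚ*/ℚ*²` and in the Selmer group. -/

/-- The two-covering of `E'₋` attached to `d` has a point over `K`. -/
def CoverSolvable (K : Type*) [Field K] [Algebra ℚ K] (d : ℚ) : Prop :=
  ∃ u w : K, algebraMap ℚ K d * w ^ 2 =
    (algebraMap ℚ K d * u ^ 2 + (S.p + S.q) * S.D) ^ 2 - 4 * S.p * S.q * S.D ^ 2

lemma E_neg_one_equation (F : Type*) [Field F] [Algebra ℚ F] {x y : F} :
    ((S.E (-1))⁄F).toAffine.Equation x y ↔ y ^ 2 = x * (x - S.p * S.D) * (x - S.q * S.D) := by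
  rw [E_equation]
  push_cast
  constructor <;> intro h <;> linear_combination h

/-- Translation by `(0, 0)` on `E₋`, written through the product `x x' = p q D²`. -/
lemma some_add_T₀ (F : Type*) [Field F] [Algebra ℚ F] {x x' s : F}
    (hxx : x * x' = S.p * S.q * S.D ^ 2)
    (h : ((S.E (-1))⁄F).toAffine.Nonsingular x (s * x))
    (h' : ((S.E (-1))⁄F).toAffine.Nonsingular x' (-s * x')) :
    Affine.Point.some x (s * x) h + S.T₀ (-1) F = Affine.Point.some x' (-s * x') h' := by
  have hne : x ≠ 0 := by
    rintro rfl
    have h0 : ((S.p * S.q * S.D ^ 2 : ℚ)) ≠ 0 := by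
      have := S.p_ne; have := S.q_ne; have := S.D_ne; positivity
    refine h0 ((algebraMap ℚ F).injective ?_)
    simp only [map_mul, map_pow, map_natCast, map_zero]
    rw [← hxx, zero_mul]
  have he := (S.E_neg_one_equation F).mp h.1
  have hx' : x' = s ^ 2 - x + (S.p + S.q) * S.D := by
    have : x * x * (x' - (s ^ 2 - x + (S.p + S.q) * S.D)) = 0 := by
      linear_combination x * hxx - he
    have := (mul_eq_zero.mp this).resolve_left (mul_ne_zero hne hne)
    linear_combination this
  have hs : ((S.E (-1))⁄F).toAffine.slope x 0 (s * x) 0 = s := by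
    rw [Affine.slope_of_X_ne hne]
    field_simp
    ring
  have hX : ((S.E (-1))⁄F).toAffine.addX x 0 s = x' := by
    rw [hx']
    simp only [Affine.addX, E, WeierstrassCurve.baseChange, WeierstrassCurve.map,
      WeierstrassCurve.toAffine]
    simp only [map_zero, map_add, map_mul, map_natCast, map_intCast]
    push_cast
    ring
  rw [T₀, Affine.Point.add_some (fun hxy => hne hxy.1)]
  simp only [Affine.Point.some.injEq, hs]
  refine ⟨hX, ?_⟩
  simp only [Affine.addY, Affine.negAddY, hX]
  simp only [Affine.negY, E, WeierstrassCurve.baseChange, WeierstrassCurve.map,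
    WeierstrassCurve.toAffine, map_zero]
  ring

/-- A point of the two-covering gives a point of `E₋` over a field containing `δ = √d`. -/
lemma cover_nonsingular (F : Type*) [Field F] [Algebra ℚ F] {δ u w s : F}
    (e : δ ^ 2 * w ^ 2 = (δ ^ 2 * u ^ 2 + (S.p + S.q) * S.D) ^ 2 - 4 * S.p * S.q * S.D ^ 2)
    (hs : s ^ 2 = δ ^ 2 * u ^ 2) :
    ((S.E (-1))⁄F).toAffine.Nonsingular ((δ ^ 2 * u ^ 2 + (S.p + S.q) * S.D - w * δ) / 2)
      (s * ((δ ^ 2 * u ^ 2 + (S.p + S.q) * S.D - w * δ) / 2)) := by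
  have : CharZero F := algebraRat.charZero F
  apply E_nonsingular
  rw [E_neg_one_equation, mul_pow, hs]
  linear_combination -((δ ^ 2 * u ^ 2 + (S.p + S.q) * S.D - w * δ) / 8) * e

/-- The factors are the two roots of `X² - (δ²u² + (p+q)D) X + pqD²`, exchanged by `w ↦ -w`; this is
the hypothesis `x x' = pqD²` of `some_add_T₀`. -/
lemma cover_mul (F : Type*) [Field F] [Algebra ℚ F] {δ u w : F}
    (e : δ ^ 2 * w ^ 2 = (δ ^ 2 * u ^ 2 + (S.p + S.q) * S.D) ^ 2 - 4 * S.p * S.q * S.D ^ 2) :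
    (δ ^ 2 * u ^ 2 + (S.p + S.q) * S.D - w * δ) / 2 *
      ((δ ^ 2 * u ^ 2 + (S.p + S.q) * S.D - -w * δ) / 2) = S.p * S.q * S.D ^ 2 := by
  have : CharZero F := algebraRat.charZero F
  linear_combination -e / 4

/-- The covering point is rational over `K`, so an automorphism moves the resulting point of `E₋`
only through its effect on `√d`. -/
lemma kummer_mem_locallyTrivial {K : Type} [Field K] [Algebra ℚ K] {d : ℚˣ}
    (h : S.CoverSolvable K (d : ℚ)) :
    (⟨S.kummerFun (-1) d, S.kummerFun_mem (-1) d⟩ : cocycles (S.kerPhi (-1) Qbar)) ∈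
      locallyTrivial (S.kerPhi (-1) Qbar) K := by
  obtain ⟨u₀, w₀, h₀⟩ := h
  intro ι
  obtain ⟨δ, hδ⟩ : ∃ δ, δ = ι (sqrtBar d) := ⟨_, rfl⟩
  obtain ⟨u, hu⟩ : ∃ u, u = algebraMap K (AlgebraicClosure K) u₀ := ⟨_, rfl⟩
  obtain ⟨w, hw⟩ : ∃ w, w = algebraMap K (AlgebraicClosure K) w₀ := ⟨_, rfl⟩
  have hδ2 : δ ^ 2 = algebraMap ℚ (AlgebraicClosure K) d := by
    rw [hδ, ← map_pow, sqrtBar_sq, AlgHom.commutes]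
  have e : δ ^ 2 * w ^ 2 =
      (δ ^ 2 * u ^ 2 + (S.p + S.q) * S.D) ^ 2 - 4 * S.p * S.q * S.D ^ 2 := by
    have := congrArg (algebraMap K (AlgebraicClosure K)) h₀
    simp only [map_mul, map_pow, map_sub, map_add, map_natCast, map_ofNat,
      ← IsScalarTower.algebraMap_apply ℚ K (AlgebraicClosure K)] at this
    rw [hδ2, hu, hw, this]
  have hns := S.cover_nonsingular (AlgebraicClosure K) e (s := u * δ) (by ring)
  have hns' := S.cover_nonsingular (AlgebraicClosure K) (δ := δ) (u := u) (w := -w) (by linear_combination e) (s := -(u * δ)) (by ring)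
  refine ⟨.some _ _ hns, fun σ τ hστ => ?_⟩
  have hσu : σ u = u := by rw [hu, AlgEquiv.commutes]
  have hσw : σ w = w := by rw [hw, AlgEquiv.commutes]
  have hσδ : σ δ = ι (τ (sqrtBar d)) := by rw [hδ, hστ]
  have hσ2 : σ 2 = 2 := map_ofNat σ 2
  rw [eq_sub_iff_add_eq]
  rw [galAct, Affine.Point.map_some]
  rcases apply_sqrtBar d τ with hτ | hτ
  · rw [hτ, ← hδ] at hσδ
    simp only [kummerFun, hτ, if_true, map_zero, zero_add, Affine.Point.some.injEq]
    simp [-ne_eq, hσδ, hσu, hσw, hσ2]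
  -- Here `σ` negates `δ`: the image of the point has the other root as abscissa and the opposite
  -- slope, so it is the translate by `(0, 0)`.
  · rw [hτ, map_neg, ← hδ] at hσδ
    have h1 : Affine.Point.map (W' := S.E (-1)) ι (S.T₀ (-1) Qbar) = S.T₀ (-1) (AlgebraicClosure K) := by
      simp [T₀, Affine.Point.map_some]
    simp only [kummerFun, hτ, neg_sqrtBar_ne, if_false, h1]
    rw [add_comm, S.some_add_T₀ (AlgebraicClosure K) (x' := (δ ^ 2 * u ^ 2 + (S.p + S.q) * S.D - (-w) * δ) / 2) _ hns hns']
    · simp [-ne_eq, hσδ, hσu, hσw, hσ2]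
    · exact S.cover_mul _ e

end TwoDescent.Data
end
-- Hensel lifting and a point count over finite fields
noncomputable section

open Polynomial

/-- A `p`-adic integer whose reduction is a nonzero square is a square, for odd `p`. -/
theorem PadicInt.exists_sq_eq_of_toZMod_eq_sq {l : ℕ} [Fact l.Prime] (hl : l ≠ 2) {x : ℤ_[l]}
    {y : ZMod l} (hy : y ≠ 0) (hxy : PadicInt.toZMod x = y ^ 2) :
    ∃ s : ℤ_[l], s ^ 2 = x ∧ PadicInt.toZMod s = y := by
  obtain ⟨a, rfl⟩ := ZMod.ringHom_surjective (PadicInt.toZMod (p := l)) y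
  have hlt : ∀ z : ℤ_[l], ‖z‖ < 1 ↔ PadicInt.toZMod z = 0 := fun z => by
    rw [← RingHom.mem_ker, PadicInt.ker_toZMod, PadicInt.mem_nonunits.symm]; rfl
  have h2 : (2 : ZMod l) ≠ 0 := by
    intro h
    have : ((2 : ℕ) : ZMod l) = 0 := by exact_mod_cast h
    rw [ZMod.natCast_eq_zero_iff] at this
    exact hl ((Nat.prime_dvd_prime_iff_eq Fact.out Nat.prime_two).mp this)
  have hd : ‖(2 * a : ℤ_[l])‖ = 1 := by
    refine le_antisymm (PadicInt.norm_le_one _) (not_lt.mp ?_)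
    rw [hlt, map_mul, map_ofNat]
    exact mul_ne_zero h2 hy
  have he : ‖a ^ 2 - x‖ < 1 := by rw [hlt, map_sub, map_pow, hxy, sub_self]
  have ev : ∀ z : ℤ_[l], (X ^ 2 - C x : ℤ_[l][X]).aeval z = z ^ 2 - x := fun z => by simp
  have dv : (X ^ 2 - C x : ℤ_[l][X]).derivative.aeval a = 2 * a := by
    simp [one_add_one_eq_two]
  obtain ⟨s, hs, hsa, -⟩ := hensels_lemma (p := l) (F := (X ^ 2 - C x : ℤ_[l][X])) (a := a)
    (by rw [ev, dv, hd]; simpa using he)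
  rw [dv, hd, hlt, map_sub, sub_eq_zero] at hsa
  rw [ev, sub_eq_zero] at hs
  exact ⟨s, hs, hsa⟩

theorem Padic.exists_sq_eq_of_jacobiSym_eq_one {l : ℕ} [Fact l.Prime] (hl : l ≠ 2) {a : ℤ}
    (ha : jacobiSym a l = 1) : ∃ s : ℚ_[l], s ^ 2 = a := by
  obtain ⟨y, hy⟩ := ZMod.isSquare_of_jacobiSym_eq_one ha
  have hy0 : y ≠ 0 := by
    rintro rfl
    rw [mul_zero, ZMod.intCast_zmod_eq_zero_iff_dvd] at hy
    have h0 : jacobiSym a l = 0 := by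
      rw [jacobiSym.mod_left, Int.emod_eq_zero_of_dvd hy,
        jacobiSym.zero_left (Fact.out : l.Prime).one_lt]
    omega
  obtain ⟨s, hs, -⟩ := PadicInt.exists_sq_eq_of_toZMod_eq_sq hl (x := (a : ℤ_[l])) hy0
    (by rw [map_intCast, hy, sq])
  exact ⟨s, by exact_mod_cast congrArg ((↑) : ℤ_[l] → ℚ_[l]) hs⟩

/-- Hensel lifting at `2` for biquadratic polynomials with odd middle coefficient. -/
theorem Padic.exists_biquadratic_root_two {A B C : ℤ} (hB : Odd B) (h : 8 ∣ A + B + C) :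
    ∃ v : ℚ_[2], A * v ^ 4 + B * v ^ 2 + C = 0 := by
  have ev : ∀ z : ℤ_[2], (Polynomial.C A * X ^ 4 + Polynomial.C B * X ^ 2 + Polynomial.C C :
      ℤ[X]).aeval z = A * z ^ 4 + B * z ^ 2 + C := fun z => by simp
  have dv : (Polynomial.C A * X ^ 4 + Polynomial.C B * X ^ 2 + Polynomial.C C :
      ℤ[X]).derivative.aeval (1 : ℤ_[2]) = ((4 * A + 2 * B : ℤ) : ℤ_[2]) := by
    simp [map_ofNat]; ring
  have h1 : ‖((A + B + C : ℤ) : ℤ_[2])‖ ≤ (2 : ℝ) ^ (-3 : ℤ) := by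
    have := (PadicInt.norm_int_le_pow_iff_dvd (p := 2) (k := A + B + C) (n := 3)).mpr
      (by norm_num; exact h)
    simpa using this
  have h2 : (2 : ℝ) ^ (-2 : ℤ) < ‖((4 * A + 2 * B : ℤ) : ℤ_[2])‖ := by
    rw [← not_le]
    intro hle
    have := (PadicInt.norm_int_le_pow_iff_dvd (p := 2) (k := 4 * A + 2 * B) (n := 2)).mp
      (by simpa using hle)
    obtain ⟨b, rfl⟩ := hB
    norm_num at this
    omega
  -- The norm takes only powers of 2 as nonzero values. With the value at `1` of norm at most `1/8`
  -- and the derivative there of norm at least `1/2`, Hensel's condition reads `1/8 < 1/4`.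
  have h3 : (2 : ℝ) ^ (-1 : ℤ) ≤ ‖((4 * A + 2 * B : ℤ) : ℤ_[2])‖ := by
    by_contra! hlt
    have := (PadicInt.norm_le_pow_iff_norm_lt_pow_add_one (p := 2)
      ((4 * A + 2 * B : ℤ) : ℤ_[2]) (-2)).mpr (by simpa using hlt)
    exact absurd h2 (not_lt.mpr (by simpa using this))
  obtain ⟨v, hv, -⟩ := hensels_lemma (p := 2) (F := (Polynomial.C A * X ^ 4 +
      Polynomial.C B * X ^ 2 + Polynomial.C C : ℤ[X])) (a := 1) (by
    rw [ev, dv]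
    have h4 : ((2 : ℝ) ^ (-1 : ℤ)) ^ 2 ≤ ‖((4 * A + 2 * B : ℤ) : ℤ_[2])‖ ^ 2 := by gcongr
    have h5 : ‖(A * 1 ^ 4 + B * 1 ^ 2 + C : ℤ_[2])‖ ≤ (2 : ℝ) ^ (-3 : ℤ) := by simpa using h1
    exact h5.trans_lt (lt_of_lt_of_le (by norm_num) h4))
  rw [ev] at hv
  exact ⟨v, by exact_mod_cast congrArg ((↑) : ℤ_[2] → ℚ_[2]) hv⟩

theorem Padic.exists_sq_eq_of_mod_eight {a : ℤ} (h : 8 ∣ a - 1) : ∃ s : ℚ_[2], s ^ 2 = a := by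
  obtain ⟨v, hv⟩ := Padic.exists_biquadratic_root_two (A := 0) (B := 1) (C := -a) odd_one
    (by omega)
  push_cast at hv
  exact ⟨v, by linear_combination hv⟩

/-- A genus one curve `c w² = (c z² + h)² - k` over a finite field has a point with `z ≠ 0`. -/
theorem FiniteField.exists_not_sq {F : Type*} [Field F] [Fintype F] (hF : (2 : F) ≠ 0)
    {c h k t : F} (hc : ¬IsSquare c) (hk : k ≠ 0) (ht : t ≠ 0) (htk : t ^ 2 - 2 * h * t + k = 0) :
    ∃ z : F, z ≠ 0 ∧ ((c * z ^ 2 + h) ^ 2 - k = 0 ∨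
      ∃ w, w ≠ 0 ∧ c * w ^ 2 = (c * z ^ 2 + h) ^ 2 - k) := by
  classical
  -- Pigeonhole instead of the Hasse bound. If there is no such point, then for all `z ≠ 0` the
  -- right side is a nonzero square `z²w²`, since `c` is a nonsquare. Then `z ↦ cz² + h + zw`
  -- injects the nonzero elements into the nonzero elements other than `t`.
  by_contra! H
  have hc0 : c ≠ 0 := by rintro rfl; exact hc (IsSquare.zero)
  have key : ∀ x : F, ∃ w : F, ∀ z, z ≠ 0 → x = c * z ^ 2 →
      w ≠ 0 ∧ z ^ 2 * w ^ 2 = (c * z ^ 2 + h) ^ 2 - k := by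
    intro x
    by_cases hx : ∃ z, z ≠ 0 ∧ x = c * z ^ 2
    · obtain ⟨z, hz, rfl⟩ := hx
      obtain ⟨hne, hw⟩ := H z hz
      have hsq : IsSquare ((c * z ^ 2 + h) ^ 2 - k) := by
        by_contra hns
        have : IsSquare (((c * z ^ 2 + h) ^ 2 - k) / c) := by
          rw [← quadraticChar_one_iff_isSquare (div_ne_zero hne hc0)]
          have h1 := quadraticChar_neg_one_iff_not_isSquare.mpr hns
          have h2 := quadraticChar_neg_one_iff_not_isSquare.mpr hc
          have h3 : quadraticChar F (((c * z ^ 2 + h) ^ 2 - k) / c) * quadraticChar F c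
              = quadraticChar F ((c * z ^ 2 + h) ^ 2 - k) := by
            rw [← map_mul, div_mul_cancel₀ _ hc0]
          rw [h1, h2] at h3
          linarith
        obtain ⟨w, hw'⟩ := this
        refine hw w ?_ ?_
        · rintro rfl
          rw [mul_zero, div_eq_zero_iff] at hw'
          exact hw'.elim hne hc0
        · rw [sq, ← hw', mul_div_cancel₀ _ hc0]
      obtain ⟨y, hy⟩ := hsq
      have hy0 : y ≠ 0 := by rintro rfl; exact hne (by rw [hy, mul_zero])
      refine ⟨y / z, fun z' hz' hzz => ⟨div_ne_zero hy0 hz, ?_⟩⟩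
      have hzz' : z' ^ 2 = z ^ 2 := (mul_left_cancel₀ hc0 hzz).symm
      rw [hzz', hy]; field_simp
    · push Not at hx
      exact ⟨0, fun z hz hzx => absurd hzx (hx z hz)⟩
  -- `W` is a function of `cz²` rather than of `z`, so `z` and `-z` share the same value;
  -- injectivity depends on this.
  choose W hW using key
  have hprod : ∀ z, z ≠ 0 → (c * z ^ 2 + h + z * W (c * z ^ 2)) *
      (c * z ^ 2 + h - z * W (c * z ^ 2)) = k := fun z hz => by
    linear_combination -(hW _ z hz rfl).2
  have hmaps : ∀ z ∈ Finset.univ.erase (0 : F), c * z ^ 2 + h + z * W (c * z ^ 2) ∈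
      (Finset.univ.erase (0 : F)).erase t := by
    intro z hz
    have hz0 := Finset.ne_of_mem_erase hz
    have hp := hprod z hz0
    simp only [Finset.mem_erase, Finset.mem_univ, and_true, ne_eq]
    refine ⟨fun h0 => ?_, fun h0 => hk (by rw [← hp, h0, zero_mul])⟩
    -- If one factor of `k` is `t`, the other is `2h - t`; their sum is then `2h`, but it is also
    -- `2(cz² + h)`.
    have h1 : t * (2 * (c * z ^ 2)) = 0 := by
      rw [h0] at hp
      linear_combination hp + htk + t * h0
    exact mul_ne_zero ht (mul_ne_zero hF (mul_ne_zero hc0 (pow_ne_zero 2 hz0))) h1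
  have hinj : Set.InjOn (fun z => c * z ^ 2 + h + z * W (c * z ^ 2))
      (Finset.univ.erase (0 : F) : Finset F) := by
    intro z hz z' hz' heq
    have hz0 := Finset.ne_of_mem_erase hz
    have hz0' := Finset.ne_of_mem_erase hz'
    have hp := hprod z hz0
    have hp' := hprod z' hz0'
    simp only at heq
    have hne : c * z ^ 2 + h + z * W (c * z ^ 2) ≠ 0 := fun h0 => hk (by rw [← hp, h0, zero_mul])
    rw [← heq, ← hp] at hp'
    have h2 := mul_left_cancel₀ hne hp'
    -- The first factor determines its cofactor in `k`, hence their sum `2(cz² + h)`.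
    have hsq : c * z ^ 2 = c * z' ^ 2 := by
      have : 2 * (c * z ^ 2 - c * z' ^ 2) = 0 := by linear_combination heq - h2
      exact sub_eq_zero.mp ((mul_eq_zero.mp this).resolve_left hF)
    rw [← hsq] at heq
    have := (hW _ z hz0 rfl).1
    exact mul_right_cancel₀ this (add_left_cancel heq)
  have hcard := Finset.card_le_card_of_injOn _ hmaps hinj
  rw [Finset.card_erase_of_mem (s := Finset.univ.erase (0 : F)) (by simp [ht])] at hcard
  have : 0 < (Finset.univ.erase (0 : F)).card := Finset.card_pos.mpr ⟨t, by simp [ht]⟩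
  omega

end
-- Local points on the two-coverings
noncomputable section

open scoped NumberTheorySymbols

theorem jacobiSym.le_one (a : ℤ) (b : ℕ) : J(a | b) ≤ 1 := by
  rcases jacobiSym.trichotomy a b with h | h | h <;> omega

theorem jacobiSym.eq_one_of_primeFactors {a : ℤ} {N : ℕ} :
    N ≠ 0 → (∀ l ∈ N.primeFactors, J(a | l) = 1) → J(a | N) = 1 := by
  induction N using Nat.recOnMul with
  | zero => exact fun h => absurd rfl h
  | one => exact fun _ _ => jacobiSym.one_right a
  | prime p hp => exact fun _ h => h p (by simp [hp.primeFactors])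
  | mul b c hb hc =>
    intro h0 h
    have hb0 := left_ne_zero_of_mul h0
    have hc0 := right_ne_zero_of_mul h0
    rw [Nat.primeFactors_mul hb0 hc0] at h
    rw [jacobiSym.mul_right' a hb0 hc0,
      hb hb0 fun l hl => h l (Finset.mem_union_left _ hl),
      hc hc0 fun l hl => h l (Finset.mem_union_right _ hl), mul_one]

theorem Int.eight_dvd_odd_sq_sub_one {x : ℤ} (hx : Odd x) : 8 ∣ x ^ 2 - 1 := by
  obtain ⟨a, rfl⟩ := hx
  obtain ⟨b, hb⟩ := (Int.even_mul_succ_self a).two_dvd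
  exact ⟨b, by linear_combination 4 * hb⟩

namespace TwoDescent.Data

open scoped Classical

variable {n : ℕ} (S : Data n)

lemma D_eq_mul (i : Fin n) : S.D = S.Di i * S.Dhat i :=
  (Finset.mul_prod_erase Finset.univ S.Di (Finset.mem_univ i)).symm

lemma D_odd : Odd S.D := by
  rw [D]
  exact Finset.prod_induction _ Odd (fun _ _ => Odd.mul) odd_one fun i _ => S.Di_odd i

lemma Dhat_odd (i : Fin n) : Odd (S.Dhat i) := by
  have := S.D_odd
  rw [S.D_eq_mul i, Nat.odd_mul] at this
  exact this.2

lemma coverSolvable_intCast (K : Type*) [Field K] [Algebra ℚ K] (d : ℤ) :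
    S.CoverSolvable K (d : ℚ) ↔ ∃ u w : K, (d : K) * w ^ 2 =
      ((d : K) * u ^ 2 + (S.p + S.q) * S.D) ^ 2 - 4 * S.p * S.q * S.D ^ 2 := by
  simp only [CoverSolvable, map_intCast]

/-- At `u = 0` the right side is `((p+q)² - 4pq)D² = ((q-p)D)²`. -/
lemma coverSolvable_of_sq {K : Type*} [Field K] [Algebra ℚ K] {d : ℤ} {r : K} (hd : d ≠ 0)
    (hr : r ^ 2 = d) : S.CoverSolvable K (d : ℚ) := by
  have : CharZero K := algebraRat.charZero K
  rw [coverSolvable_intCast]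
  have hr0 : r ≠ 0 := by
    rintro rfl
    rw [zero_pow two_ne_zero, eq_comm, Int.cast_eq_zero] at hr
    exact hd hr
  refine ⟨0, (S.q - S.p) * S.D / r, ?_⟩
  rw [← hr]
  field_simp
  ring

lemma coverSolvable_real_of_pos {d : ℤ} (hd : 0 < d) : S.CoverSolvable ℝ (d : ℚ) :=
  S.coverSolvable_of_sq hd.ne' (Real.sq_sqrt (by exact_mod_cast hd.le))

lemma coverSolvable_real_neg_one : S.CoverSolvable ℝ ((-1 : ℤ) : ℚ) := by
  rw [coverSolvable_intCast]
  -- This `u` makes the squared term vanish, so both sides become `-4pqD²`.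
  refine ⟨√((S.p + S.q) * S.D), √(4 * S.p * S.q * S.D ^ 2), ?_⟩
  rw [Real.sq_sqrt (by positivity), Real.sq_sqrt (by positivity)]
  push_cast
  ring

/-- The covering has good reduction at `l`. If `d` is a square modulo `l` it is one in `ℚ_l`;
otherwise the point from `FiniteField.exists_not_sq` lifts. -/
lemma coverSolvable_of_good {l : ℕ} [hl : Fact l.Prime] {d : ℤ} (hl2 : l ≠ 2) (hp : l ≠ S.p)
    (hq : l ≠ S.q) (hD : ¬l ∣ S.D) (hd : ¬(l : ℤ) ∣ d) : S.CoverSolvable ℚ_[l] (d : ℚ) := by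
  have hpr : ∀ {r : ℕ}, r.Prime → l ≠ r → (r : ZMod l) ≠ 0 := fun hr hlr h0 =>
    hlr ((Nat.prime_dvd_prime_iff_eq hl.out hr).mp ((ZMod.natCast_eq_zero_iff _ _).mp h0))
  have h2 : (2 : ZMod l) ≠ 0 := by exact_mod_cast hpr Nat.prime_two hl2
  have hp0 := hpr S.p_prime hp
  have hq0 := hpr S.q_prime hq
  have hD0 : (S.D : ZMod l) ≠ 0 := fun h0 => hD ((ZMod.natCast_eq_zero_iff _ _).mp h0)
  have hd0 : (d : ZMod l) ≠ 0 := fun h0 => hd ((ZMod.intCast_zmod_eq_zero_iff_dvd _ _).mp h0)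
  have hdz : d ≠ 0 := by rintro rfl; exact hd (dvd_zero _)
  by_cases hsq : IsSquare (d : ZMod l)
  · obtain ⟨y, hy⟩ := hsq
    have hy0 : y ≠ 0 := by rintro rfl; exact hd0 (by rw [hy, mul_zero])
    obtain ⟨s, hs, -⟩ := PadicInt.exists_sq_eq_of_toZMod_eq_sq hl2 (x := (d : ℤ_[l])) hy0
      (by rw [map_intCast, hy, sq])
    exact S.coverSolvable_of_sq hdz (r := (s : ℚ_[l])) (by exact_mod_cast congrArg _ hs)
  have hdp : (d : ℚ_[l]) ≠ 0 := by exact_mod_cast hdz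
  -- `t = 2qD` is the root `h + (q-p)D` of `T² - 2hT + k`.
  obtain ⟨z, hz, hc⟩ := FiniteField.exists_not_sq h2 hsq
    (h := (S.p + S.q) * S.D) (k := 4 * S.p * S.q * S.D ^ 2) (t := 2 * S.q * S.D)
    (by
      have : (4 : ZMod l) = 2 * 2 := by norm_num
      rw [this]
      exact mul_ne_zero (mul_ne_zero (mul_ne_zero (mul_ne_zero h2 h2) hp0) hq0)
        (pow_ne_zero 2 hD0))
    (mul_ne_zero (mul_ne_zero h2 hq0) hD0) (by ring)
  rw [coverSolvable_intCast]
  rcases hc with hc | ⟨w, hw, hc⟩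
  · have hne : (d : ZMod l) * z ^ 2 + (S.p + S.q) * S.D ≠ 0 := by
      intro h0
      rw [h0, zero_pow two_ne_zero, zero_sub, neg_eq_zero] at hc
      have : (4 : ZMod l) = 2 * 2 := by norm_num
      rw [this] at hc
      exact mul_ne_zero (mul_ne_zero (mul_ne_zero (mul_ne_zero h2 h2) hp0) hq0)
        (pow_ne_zero 2 hD0) hc
    -- The point has `w = 0`, so the lift is made in `u`: first a root `κ` of `4pqD²` near `dz² +
    -- h`, then a root of `d(κ - h)` near `dz`.
    obtain ⟨κ, hκ, hκ'⟩ := PadicInt.exists_sq_eq_of_toZMod_eq_sq hl2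
      (x := (4 * S.p * S.q * S.D ^ 2 : ℤ_[l])) hne
      (by simp only [map_mul, map_pow, map_natCast, map_ofNat]; linear_combination -hc)
    obtain ⟨u, hu, -⟩ := PadicInt.exists_sq_eq_of_toZMod_eq_sq hl2
      (x := (d * (κ - (S.p + S.q) * S.D) : ℤ_[l])) (mul_ne_zero hd0 hz)
      (by simp only [map_mul, map_sub, map_add, map_natCast, map_intCast, hκ']; ring)
    have hκc : (κ : ℚ_[l]) ^ 2 = 4 * S.p * S.q * S.D ^ 2 := by
      exact_mod_cast congrArg ((↑) : ℤ_[l] → ℚ_[l]) hκ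
    have huc : (u : ℚ_[l]) ^ 2 = d * (κ - (S.p + S.q) * S.D) := by
      have := congrArg ((↑) : ℤ_[l] → ℚ_[l]) hu
      push_cast at this
      exact this
    refine ⟨u / d, 0, ?_⟩
    rw [div_pow, huc, ← hκc]
    field_simp
    ring
  · obtain ⟨z, rfl⟩ := ZMod.ringHom_surjective (PadicInt.toZMod (p := l)) z
    obtain ⟨s, hs, -⟩ := PadicInt.exists_sq_eq_of_toZMod_eq_sq hl2
      (x := (d * ((d * z ^ 2 + (S.p + S.q) * S.D) ^ 2 - 4 * S.p * S.q * S.D ^ 2) : ℤ_[l]))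
      (mul_ne_zero hd0 hw)
      (by
        simp only [map_mul, map_sub, map_add, map_pow, map_natCast, map_intCast, map_ofNat]
        linear_combination -(d : ZMod l) * hc)
    have hsc : (s : ℚ_[l]) ^ 2 =
        d * ((d * z ^ 2 + (S.p + S.q) * S.D) ^ 2 - 4 * S.p * S.q * S.D ^ 2) := by
      have := congrArg ((↑) : ℤ_[l] → ℚ_[l]) hs
      push_cast at this
      exact this
    refine ⟨z, s / d, ?_⟩
    rw [div_pow, hsc]
    field_simp

/-! ### Solvability at `2` -/

/-- Putting `u = 2v`, `w = 4y` and dividing by `16d` turns the covering into `y² = d v⁴ + (p +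
2^(k+1))D v² + e`. The middle coefficient is odd, so for a fixed integer `y` Hensel's lemma applies
at `v = 1`. -/
lemma coverSolvable_two_of_mod_eight {k : ℕ} (hm : S.m = k + 2) {d e y : ℤ}
    (hde : d * e = 4 ^ k * S.D ^ 2) (h : 8 ∣ d + (S.p + 2 ^ (k + 1)) * S.D + e - y ^ 2) :
    S.CoverSolvable ℚ_[2] (d : ℚ) := by
  have hB : Odd (((S.p : ℤ) + 2 ^ (k + 1)) * S.D) := by
    refine Odd.mul (Odd.add_even (by exact_mod_cast S.p_odd) ?_) (by exact_mod_cast S.D_odd)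
    exact even_two.pow_of_ne_zero (Nat.succ_ne_zero k)
  obtain ⟨v, hv⟩ := Padic.exists_biquadratic_root_two (A := d) (C := e - y ^ 2) hB
    (by rw [← add_sub_assoc]; exact h)
  rw [coverSolvable_intCast]
  refine ⟨2 * v, 4 * y, ?_⟩
  have hq : (S.q : ℚ_[2]) = S.p + 4 * 2 ^ k := by
    rw [S.q_eq, hm]; push_cast; ring
  have hde' : (d : ℚ_[2]) * e = (2 ^ k) ^ 2 * S.D ^ 2 := by
    have : (d : ℚ_[2]) * e = 4 ^ k * S.D ^ 2 := by exact_mod_cast congrArg ((↑) : ℤ → ℚ_[2]) hde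
    rw [this, ← pow_mul, mul_comm k 2, pow_mul]; norm_num
  push_cast [pow_succ] at hv
  rw [hq]
  linear_combination -16 * d * hv + 16 * hde'

lemma coverSolvable_two_of_four_dvd {k : ℕ} (hm : S.m = k + 2) {d e : ℤ}
    (hde : d * e = 4 ^ k * S.D ^ 2) (h : 4 ∣ d + (S.p + 2 ^ (k + 1)) * S.D + e) :
    S.CoverSolvable ℚ_[2] (d : ℚ) := by
  by_cases h8 : 8 ∣ d + (S.p + 2 ^ (k + 1)) * S.D + e
  · exact S.coverSolvable_two_of_mod_eight hm hde (y := 0) (by simpa using h8)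
  -- The values `y = 0` and `y = 2` cover the residues 0 and 4 modulo 8.
  · exact S.coverSolvable_two_of_mod_eight hm hde (y := 2) (by omega)

end TwoDescent.Data
end
-- The classes of -1, 2 and Dᵢ in the Selmer group
noncomputable section

open scoped NumberTheorySymbols

namespace TwoDescent.Data

open scoped Classical

variable {n : ℕ} (S : Data n)

lemma mk_mem_selmerPhiSq {t : ℚˣ} {d : ℤ} (ht : (t : ℚ) = d)
    (hR : S.CoverSolvable ℝ (d : ℚ)) (h2 : S.CoverSolvable ℚ_[2] (d : ℚ))
    (hbad : ∀ (l : ℕ) [Fact l.Prime], l ≠ 2 → ((l : ℤ) ∣ d ∨ l ∈ (S.p * S.q * S.D).primeFactors) →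
      S.CoverSolvable ℚ_[l] (d : ℚ)) :
    (t : SqClass) ∈ S.selmerPhiSq (-1) := by
  rw [← ht] at hR h2 hbad
  change H1.mk _ ⟨S.kummerFun (-1) t, S.kummerFun_mem (-1) t⟩ ∈ selmer (S.kerPhi (-1) Qbar)
  refine AddSubgroup.mem_map_of_mem _ (AddSubgroup.mem_inf.mpr
    ⟨S.kummer_mem_locallyTrivial hR, ?_⟩)
  simp only [AddSubgroup.mem_iInf]
  intro l hl
  apply S.kummer_mem_locallyTrivial
  by_cases hl2 : l = 2
  · subst hl2; exact h2
  by_cases hld : (l : ℤ) ∣ d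
  · exact hbad l hl2 (Or.inl hld)
  by_cases hlb : l ∈ (S.p * S.q * S.D).primeFactors
  · exact hbad l hl2 (Or.inr hlb)
  have h0 : S.p * S.q * S.D ≠ 0 :=
    mul_ne_zero (mul_ne_zero S.p_prime.ne_zero S.q_prime.ne_zero) S.D_pos.ne'
  have hndvd : ¬l ∣ S.p * S.q * S.D := fun h => hlb (Nat.mem_primeFactors.mpr ⟨hl.out, h, h0⟩)
  rw [ht]
  refine S.coverSolvable_of_good hl2 ?_ ?_ (fun h => hndvd (h.mul_left _)) hld
  · rintro rfl; exact hndvd ((dvd_mul_right _ _).mul_right _)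
  · rintro rfl; exact hndvd ((dvd_mul_left _ _).mul_right _)

lemma coverSolvable_of_jacobiSym {l : ℕ} [Fact l.Prime] (hl : l ≠ 2) {d : ℤ} (hd : d ≠ 0)
    (h : J(d | l) = 1) : S.CoverSolvable ℚ_[l] (d : ℚ) := by
  obtain ⟨s, hs⟩ := Padic.exists_sq_eq_of_jacobiSym_eq_one hl h
  exact S.coverSolvable_of_sq hd hs

/-! ### The class of `-1` -/

lemma PiNegOne_eq_zero_iff : S.PiNegOne = 0 ↔
    (S.p * S.D ≡ 1 [MOD 8] ∨ (3 ≤ S.m ∧ S.p * S.D ≡ 5 [MOD 8])) ∧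
      ∀ l ∈ (S.p * S.q * S.D).primeFactors, J(-1 | l) = 1 := by
  have h1 : ∀ l ∈ (S.p * S.q * S.D).primeFactors, 0 ≤ 1 - J(-1 | l) := fun l _ =>
    sub_nonneg.mpr (jacobiSym.le_one _ _)
  rw [PiNegOne, add_eq_zero_iff_of_nonneg (by split_ifs <;> simp) (Finset.sum_nonneg h1),
    Finset.sum_eq_zero_iff_of_nonneg h1]
  exact and_congr (by split_ifs with h <;> simp [h])
    (forall₂_congr fun l _ => by rw [sub_eq_zero, eq_comm])

lemma coverSolvable_two_neg_one (hm : 2 ≤ S.m) (h : S.PiNegOne = 0) :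
    S.CoverSolvable ℚ_[2] ((-1 : ℤ) : ℚ) := by
  obtain ⟨hδ, hJ⟩ := S.PiNegOne_eq_zero_iff.mp h
  obtain ⟨k, hk⟩ := Nat.exists_eq_add_of_le' hm
  -- Multiplicativity of the symbol `J(-1 | ·)` over the primes of `D`; for `m = 2` this fixes `2D`
  -- modulo 8.
  have hD4 : S.D % 4 = 1 := by
    have h1 : J(-1 | S.D) = 1 := jacobiSym.eq_one_of_primeFactors S.D_pos.ne' fun l hl => hJ l
      (Nat.primeFactors_mono (dvd_mul_left _ _) (mul_ne_zero (mul_ne_zero S.p_prime.ne_zero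
        S.q_prime.ne_zero) S.D_pos.ne') hl)
    rw [jacobiSym.at_neg_one S.D_odd, ZMod.χ₄_nat_eq_if_mod_four] at h1
    by_contra hne
    simp [hne] at h1
    (split_ifs at h1; omega)
  have hDD := Int.eight_dvd_odd_sq_sub_one (x := S.D) (by exact_mod_cast S.D_odd)
  have hpD : (8 : ℤ) ∣ S.p * S.D - 1 ∨ (1 ≤ k ∧ (8 : ℤ) ∣ S.p * S.D - 5) := by
    rcases hδ with h | ⟨h3, h⟩
    · left
      have := (Nat.modEq_iff_dvd.mp h.symm)
      exact_mod_cast this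
    · right
      have := (Nat.modEq_iff_dvd.mp h.symm)
      exact ⟨by omega, by exact_mod_cast this⟩
  rcases Nat.eq_zero_or_pos k with rfl | hk0
  · refine S.coverSolvable_two_of_mod_eight hk (e := -(4 ^ 0 * S.D ^ 2)) (y := 1) (by ring) ?_
    have h2 : (S.D : ℤ) % 4 = 1 := by exact_mod_cast hD4
    have e1 : (-1 + (S.p + 2 ^ (0 + 1)) * S.D + -(4 ^ 0 * S.D ^ 2) - 1 ^ 2 : ℤ) =
      S.p * S.D + 2 * S.D - (S.D ^ 2 - 1) - 3 := by ring
    rw [e1]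
    omega
  · obtain ⟨j, rfl⟩ := Nat.exists_eq_add_of_le' hk0
    refine S.coverSolvable_two_of_four_dvd hk (e := -(4 ^ (j + 1) * S.D ^ 2)) (by ring) ?_
    have e1 : (-1 + (S.p + 2 ^ (j + 1 + 1)) * S.D + -(4 ^ (j + 1) * S.D ^ 2) : ℤ) =
      S.p * S.D - 1 + 4 * (2 ^ j * S.D - 4 ^ j * S.D ^ 2) := by ring
    rw [e1]
    omega

lemma neg_one_mem_selmerPhiSq (hm : 2 ≤ S.m) (h : S.PiNegOne = 0) :
    ((-1 : ℚˣ) : SqClass) ∈ S.selmerPhiSq (-1) := by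
  refine S.mk_mem_selmerPhiSq (d := -1) (by simp) S.coverSolvable_real_neg_one
    (S.coverSolvable_two_neg_one hm h) fun l hl hl2 hlb => ?_
  rcases hlb with hlb | hlb
  · exact absurd (Int.isUnit_iff_natAbs_eq.mp (isUnit_of_dvd_unit hlb (by simp)))
      (by simpa using hl.out.ne_one)
  · exact S.coverSolvable_of_jacobiSym hl2 (by norm_num) ((S.PiNegOne_eq_zero_iff.mp h).2 l hlb)

/-! ### The class of `2` -/

lemma PiTwo_eq_zero_iff : S.PiTwo = 0 ↔
    ((S.m = 3 ∧ S.p * S.D ≡ 1 [MOD 8]) ∨ (S.m = 4 ∧ (S.p * S.D : ℤ) ≡ -1 [ZMOD 8]) ∨ 5 ≤ S.m) ∧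
      ∀ l ∈ (S.p * S.q * S.D).primeFactors, J(2 | l) = 1 := by
  have h1 : ∀ l ∈ (S.p * S.q * S.D).primeFactors, 0 ≤ 1 - J(2 | l) := fun l _ =>
    sub_nonneg.mpr (jacobiSym.le_one _ _)
  rw [PiTwo, add_eq_zero_iff_of_nonneg (by split_ifs <;> simp) (Finset.sum_nonneg h1),
    Finset.sum_eq_zero_iff_of_nonneg h1]
  exact and_congr (by split_ifs with h <;> simp [h])
    (forall₂_congr fun l _ => by rw [sub_eq_zero, eq_comm])

lemma coverSolvable_two_two (h : S.PiTwo = 0) : S.CoverSolvable ℚ_[2] ((2 : ℤ) : ℚ) := by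
  obtain ⟨hδ, hJ⟩ := S.PiTwo_eq_zero_iff.mp h
  have hm : 3 ≤ S.m := by rcases hδ with h | h | h <;> omega
  obtain ⟨k, hk⟩ := Nat.exists_eq_add_of_le' hm
  have hpD8 : (8 : ℤ) ∣ S.p * S.D - 1 ∨ (8 : ℤ) ∣ S.p * S.D + 1 := by
    have h1 : J(2 | S.p * S.D) = 1 := jacobiSym.eq_one_of_primeFactors
      (mul_ne_zero S.p_prime.ne_zero S.D_pos.ne') fun l hl => hJ l
      (Nat.primeFactors_mono ⟨S.q, by ring⟩ (mul_ne_zero (mul_ne_zero S.p_prime.ne_zero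
        S.q_prime.ne_zero) S.D_pos.ne') hl)
    rw [jacobiSym.at_two (S.p_odd.mul S.D_odd), ZMod.χ₈_nat_eq_if_mod_eight] at h1
    have : (S.p * S.D) % 8 = 1 ∨ (S.p * S.D) % 8 = 7 := by
      by_contra hne
      simp [hne] at h1
      (split_ifs at h1; omega)
    zify at this
    omega
  have hDD := Int.eight_dvd_odd_sq_sub_one (x := S.D) (by exact_mod_cast S.D_odd)
  have hDo : (S.D : ℤ) % 2 = 1 := Int.odd_iff.mp (by exact_mod_cast S.D_odd)
  -- For `m ≥ 5` the sign in `pD ≡ ±1` decides which substitution works: `u = 4` for `+1`, and `u =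
  -- 2v` with `v` a 2-adic unit near 1 for `-1`. The cases `m = 3, 4` use the second one.
  by_cases hcase : 2 ≤ k ∧ (8 : ℤ) ∣ S.p * S.D - 1
  · obtain ⟨hk2, h8⟩ := hcase
    obtain ⟨j, rfl⟩ := Nat.exists_eq_add_of_le' hk2
    obtain ⟨y, hy⟩ := Padic.exists_sq_eq_of_mod_eight
      (a := 8 + (S.p + 2 ^ (j + 4)) * S.D + 8 * 4 ^ j * S.D ^ 2) (by
        have e1 : (8 + (S.p + 2 ^ (j + 4)) * S.D + 8 * 4 ^ j * S.D ^ 2 - 1 : ℤ) =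
          8 * (1 + 2 * 2 ^ j * S.D + 4 ^ j * S.D ^ 2) + (S.p * S.D - 1) := by ring
        rw [e1]; omega)
    rw [coverSolvable_intCast]
    have hq : (S.q : ℚ_[2]) = S.p + 32 * 2 ^ j := by
      rw [S.q_eq, hk]; push_cast; ring
    have h4 : (4 : ℚ_[2]) ^ j = (2 ^ j) ^ 2 := by
      rw [← pow_mul, mul_comm j 2, pow_mul]; norm_num
    -- With `u = 4`, `w = 8y` everything is divisible by 128, and the quotient is the unit congruent
    -- to `pD` modulo 8 whose root is `y`.
    refine ⟨4, 8 * y, ?_⟩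
    push_cast [pow_succ, h4] at hy
    rw [hq]
    push_cast
    linear_combination 128 * hy
  · refine S.coverSolvable_two_of_mod_eight (k := k + 1) (by omega) (e := 2 * 4 ^ k * S.D ^ 2)
      (y := 1) (by ring) ?_
    have e1 : (2 + (S.p + 2 ^ (k + 1 + 1)) * S.D + 2 * 4 ^ k * S.D ^ 2 - 1 ^ 2 : ℤ) =
      1 + S.p * S.D + 4 * (2 ^ k * S.D) + 2 * (4 ^ k * S.D ^ 2) := by ring
    rw [e1]
    rcases hδ with ⟨h3, h8⟩ | ⟨h4, h8⟩ | h5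
    · obtain rfl : k = 0 := by omega
      have h8' : (8 : ℤ) ∣ S.p * S.D - 1 := by exact_mod_cast Nat.modEq_iff_dvd.mp h8.symm
      simp only [pow_zero, one_mul]
      omega
    · obtain rfl : k = 1 := by omega
      have h8' : (8 : ℤ) ∣ S.p * S.D - -1 := Int.modEq_iff_dvd.mp h8.symm
      simp only [pow_one]
      omega
    · obtain ⟨j, rfl⟩ : ∃ j, k = j + 2 := ⟨k - 2, by omega⟩
      have h8' : (8 : ℤ) ∣ S.p * S.D + 1 := hpD8.resolve_left fun h => hcase ⟨by omega, h⟩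
      have e2 : (1 + S.p * S.D + 4 * (2 ^ (j + 2) * S.D) + 2 * (4 ^ (j + 2) * S.D ^ 2) : ℤ) =
        S.p * S.D + 1 + 8 * (2 * 2 ^ j * S.D + 4 * 4 ^ j * S.D ^ 2) := by ring
      rw [e2]
      omega

lemma two_mem_selmerPhiSq (h : S.PiTwo = 0) :
    ((Units.mk0 2 two_ne_zero : ℚˣ) : SqClass) ∈ S.selmerPhiSq (-1) := by
  refine S.mk_mem_selmerPhiSq (d := 2) (by simp)
    (S.coverSolvable_real_of_pos (by norm_num)) (S.coverSolvable_two_two h)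
    fun l hl hl2 hlb => ?_
  rcases hlb with hlb | hlb
  · exact absurd ((Nat.prime_dvd_prime_iff_eq hl.out Nat.prime_two).mp (by exact_mod_cast hlb)) hl2
  · exact S.coverSolvable_of_jacobiSym hl2 (by norm_num) ((S.PiTwo_eq_zero_iff.mp h).2 l hlb)

/-! ### The class of `Dᵢ` -/

lemma PiD_eq_zero_iff (i : Fin n) : S.PiD i = 0 ↔
    (S.Di i ≡ 1 [MOD 4] ∨ (S.m = 2 ∧ S.p + S.D ≡ 2 [MOD 8]) ∨ (3 ≤ S.m ∧ S.p ≡ S.D [MOD 4])) ∧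
      (J(-(S.q * S.Dhat i : ℤ) | S.Di i) = 1 ∨ J(-(S.p * S.Dhat i : ℤ) | S.Di i) = 1) ∧
      ∀ l ∈ (S.p * S.q * S.Dhat i).primeFactors, J((S.Di i : ℤ) | l) = 1 := by
  have h1 : ∀ l ∈ (S.p * S.q * S.Dhat i).primeFactors, 0 ≤ 1 - J((S.Di i : ℤ) | l) := fun l _ =>
    sub_nonneg.mpr (jacobiSym.le_one _ _)
  have h2 : 0 ≤ (1 - J(-(S.q * S.Dhat i : ℤ) | S.Di i)) * (1 - J(-(S.p * S.Dhat i : ℤ) | S.Di i)) :=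
    mul_nonneg (sub_nonneg.mpr (jacobiSym.le_one _ _)) (sub_nonneg.mpr (jacobiSym.le_one _ _))
  have h0 : (0 : ℤ) ≤ if S.Di i ≡ 1 [MOD 4] ∨ (S.m = 2 ∧ S.p + S.D ≡ 2 [MOD 8]) ∨
    (3 ≤ S.m ∧ S.p ≡ S.D [MOD 4]) then 0 else 1 := by split_ifs <;> simp
  rw [PiD, add_eq_zero_iff_of_nonneg (add_nonneg h0 h2) (Finset.sum_nonneg h1),
    add_eq_zero_iff_of_nonneg h0 h2, Finset.sum_eq_zero_iff_of_nonneg h1, and_assoc]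
  refine and_congr (by split_ifs with h <;> simp [h]) (and_congr ?_
    (forall₂_congr fun l _ => by rw [sub_eq_zero, eq_comm]))
  rw [mul_eq_zero, sub_eq_zero, sub_eq_zero, eq_comm, @eq_comm ℤ 1]

lemma coverSolvable_two_Di (hm : 2 ≤ S.m) (i : Fin n) (h : S.PiD i = 0) :
    S.CoverSolvable ℚ_[2] ((S.Di i : ℤ) : ℚ) := by
  obtain ⟨hδ, -, -⟩ := (S.PiD_eq_zero_iff i).mp h
  obtain ⟨k, hk⟩ := Nat.exists_eq_add_of_le' hm
  have hDm : (S.D : ℤ) = S.Di i * S.Dhat i := by exact_mod_cast S.D_eq_mul i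
  obtain ⟨d, hd⟩ : ∃ d : ℤ, d = S.Di i := ⟨_, rfl⟩
  obtain ⟨c, hc⟩ : ∃ c : ℤ, c = S.Dhat i := ⟨_, rfl⟩
  have hdo : Odd d := by rw [hd]; exact_mod_cast S.Di_odd i
  have hco : Odd c := by rw [hc]; exact_mod_cast S.Dhat_odd i
  have hpo : Odd (S.p : ℤ) := by exact_mod_cast S.p_odd
  have hd0 : d ≠ 0 := by rintro rfl; exact absurd hdo (by decide)
  rw [← hd, ← hc] at hDm
  obtain ⟨c', hc'⟩ := Int.eight_dvd_odd_sq_sub_one hco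
  obtain ⟨d', hd'⟩ := Int.eight_dvd_odd_sq_sub_one hdo
  obtain ⟨p', hp'⟩ := Int.eight_dvd_odd_sq_sub_one hpo
  have hc2 : c ^ 2 = 8 * c' + 1 := by linear_combination hc'
  have hd2 : d ^ 2 = 8 * d' + 1 := by linear_combination hd'
  have hp2 : (S.p : ℤ) ^ 2 = 8 * p' + 1 := by linear_combination hp'
  have hd_odd := Int.odd_iff.mp hdo
  rw [← hd]
  by_cases h1 : 8 ∣ d - 1
  · obtain ⟨s, hs⟩ := Padic.exists_sq_eq_of_mod_eight h1
    exact S.coverSolvable_of_sq hd0 hs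
  -- At `u = 1`, dividing by `d` leaves `w² = d + 4·(odd) + 16·(…)`, which is 1 modulo 8 when `d ≡
  -- 5`, whatever `m`, `p` and `D` are. Only `d ≡ 3 (mod 4)` requires the further conditions in
  -- `δᵢ`.
  by_cases h5 : 8 ∣ d - 5
  · have hBo : Odd (((S.p : ℤ) + 2 * 2 ^ k) * S.D) := by
      refine Odd.mul (Odd.add_even hpo (even_two.mul_right _)) ?_
      rw [hDm]; exact hdo.mul hco
    obtain ⟨b, hb⟩ := hBo
    obtain ⟨w, hw⟩ := Padic.exists_sq_eq_of_mod_eight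
      (a := d + 4 * ((S.p + 2 * 2 ^ k) * S.D) + 16 * 4 ^ k * (d * c ^ 2)) (by
        have e1 : d + 4 * ((S.p + 2 * 2 ^ k) * S.D) + 16 * 4 ^ k * (d * c ^ 2) - 1 =
          (d - 5) + 8 * (b + 1 + 2 * 4 ^ k * (d * c ^ 2)) := by rw [hb]; ring
        rw [e1]; omega)
    rw [coverSolvable_intCast]
    have hq : (S.q : ℚ_[2]) = S.p + 4 * 2 ^ k := by
      rw [S.q_eq, hk]; push_cast; ring
    have h4 : (4 : ℚ_[2]) ^ k = (2 ^ k) ^ 2 := by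
      rw [← pow_mul, mul_comm k 2, pow_mul]; norm_num
    have hDc : (S.D : ℚ_[2]) = d * c := by exact_mod_cast congrArg ((↑) : ℤ → ℚ_[2]) hDm
    refine ⟨1, w, ?_⟩
    push_cast [h4] at hw
    rw [hDc] at hw ⊢
    rw [hq]
    linear_combination d * hw
  have hd4 : d % 4 = 3 := by omega
  rcases hδ with h | ⟨h2, h⟩ | ⟨h3, h⟩
  · exfalso
    have : S.Di i % 4 = 1 := h
    omega
  · obtain rfl : k = 0 := by omega
    refine S.coverSolvable_two_of_mod_eight hk (e := d * c ^ 2) (y := 1)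
      (by rw [hDm]; ring) ?_
    obtain ⟨a, ha⟩ : (8 : ℤ) ∣ S.p + S.D - 2 := by exact_mod_cast Nat.modEq_iff_dvd.mp h.symm
    have hcd : (S.D : ℤ) ^ 2 = 64 * c' * d' + 8 * c' + 8 * d' + 1 := by
      rw [hDm, mul_pow, hc2, hd2]; ring
    have hDo : Odd (S.D : ℤ) := by exact_mod_cast S.D_odd
    obtain ⟨b, hb⟩ := hDo
    -- From `p + D ≡ 2` and `D² ≡ 1` one gets `(p + 2)D ≡ 4D - 1 ≡ 3 (mod 8)`; what remains is `2d +
    -- 2`, divisible by 8 as `d ≡ 3 (mod 4)`.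
    have e1 : d + (S.p + 2 ^ (0 + 1)) * S.D + d * c ^ 2 - 1 ^ 2 =
        2 * d + 2 + 8 * (b + a * S.D + d * c' - 8 * c' * d' - c' - d') := by
      rw [hc2]
      linear_combination S.D * ha - hcd + 4 * hb
    rw [e1]
    omega
  · obtain ⟨j, rfl⟩ : ∃ j, k = j + 1 := ⟨k - 1, by omega⟩
    refine S.coverSolvable_two_of_four_dvd hk (e := 4 ^ (j + 1) * (d * c ^ 2))
      (by rw [hDm]; ring) ?_
    obtain ⟨a, ha⟩ : (4 : ℤ) ∣ S.D - S.p := by exact_mod_cast Nat.modEq_iff_dvd.mp h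
    have e1 : d + (S.p + 2 ^ (j + 1 + 1)) * S.D + 4 ^ (j + 1) * (d * c ^ 2) =
        d + 1 + 4 * (2 * p' + S.p * a + 2 ^ j * S.D + 4 ^ j * (d * c ^ 2)) := by
      linear_combination S.p * ha + hp2
    rw [e1]
    omega

/-- `Π = 0` gives only one of the two symbols. Their product is the symbol of `pq` over `Dᵢ` up to a
square, and as `pq ≡ 1 (mod 4)` reciprocity equates it with `J(Dᵢ | pq) = 1`. -/
lemma Di_sq_classes (hm : 2 ≤ S.m) (i : Fin n) (h : S.PiD i = 0) :
    J(-(S.q * S.Dhat i : ℤ) | S.Di i) = 1 ∧ J(-(S.p * S.Dhat i : ℤ) | S.Di i) = 1 := by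
  obtain ⟨-, hab, hJ⟩ := (S.PiD_eq_zero_iff i).mp h
  have hpq4 : (S.p * S.q) % 4 = 1 := by
    obtain ⟨k, hk⟩ := Nat.exists_eq_add_of_le' hm
    obtain ⟨b, hb⟩ := S.p_odd
    have : S.p * S.q = 4 * (b ^ 2 + b + S.p * 2 ^ k) + 1 := by
      rw [S.q_eq, hk, hb]; ring
    omega
  have h0 : S.p * S.q ≠ 0 := mul_ne_zero S.p_prime.ne_zero S.q_prime.ne_zero
  have hDh : S.Dhat i ≠ 0 := (S.Dhat_odd i).pos.ne'
  have h1 : J((S.p * S.q : ℕ) | S.Di i) = 1 := by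
    rw [jacobiSym.quadratic_reciprocity_one_mod_four hpq4 (S.Di_odd i)]
    exact jacobiSym.eq_one_of_primeFactors h0 fun l hl => hJ l
      (Nat.primeFactors_mono (dvd_mul_right _ _) (mul_ne_zero h0 hDh) hl)
  have h2 : J(-(S.q * S.Dhat i : ℤ) | S.Di i) * J(-(S.p * S.Dhat i : ℤ) | S.Di i) =
      J((S.Dhat i : ℤ) | S.Di i) ^ 2 := by
    rw [← jacobiSym.mul_left, ← jacobiSym.pow_left]
    have : (-(S.q * S.Dhat i : ℤ)) * -(S.p * S.Dhat i : ℤ) =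
      ((S.p * S.q : ℕ) : ℤ) * (S.Dhat i : ℤ) ^ 2 := by push_cast; ring
    rw [this, jacobiSym.mul_left, h1, one_mul]
  have hne : J((S.Dhat i : ℤ) | S.Di i) ≠ 0 := by
    intro h0
    have hz : ∀ r : ℕ, J(-(r * S.Dhat i : ℤ) | S.Di i) = 0 := fun r => by
      rw [← neg_mul, jacobiSym.mul_left, h0, mul_zero]
    rw [hz, hz] at hab
    omega
  have hsq : J((S.Dhat i : ℤ) | S.Di i) ^ 2 = 1 := by
    rcases jacobiSym.trichotomy (S.Dhat i : ℤ) (S.Di i) with h | h | h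
    · exact absurd h hne
    all_goals rw [h]; norm_num
  rw [hsq] at h2
  rcases hab with h | h
  · rw [h, one_mul] at h2; exact ⟨h, h2⟩
  · rw [h, mul_one] at h2; exact ⟨h2, h⟩

lemma coverSolvable_Di_Di (hm : 2 ≤ S.m) (i : Fin n) [Fact (S.Di i).Prime] (h : S.PiD i = 0) :
    S.CoverSolvable ℚ_[S.Di i] ((S.Di i : ℤ) : ℚ) := by
  obtain ⟨h1, h2⟩ := S.Di_sq_classes hm i h
  have hl : S.Di i ≠ 2 := by
    intro h; have := S.Di_odd i; rw [h] at this; exact absurd this (by decide)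
  obtain ⟨s, hs⟩ := Padic.exists_sq_eq_of_jacobiSym_eq_one hl h1
  obtain ⟨t, ht⟩ := Padic.exists_sq_eq_of_jacobiSym_eq_one hl h2
  push_cast at hs ht
  rw [coverSolvable_intCast]
  -- With `s² = -q D/Dᵢ` and `t² = -p D/Dᵢ`, the cross term alone survives: `Dᵢu² + (p+q)D = 2Dᵢst`,
  -- whose square is `4pqD²`.
  refine ⟨s + t, 0, ?_⟩
  have hD : (S.D : ℚ_[S.Di i]) = S.Di i * S.Dhat i := by
    exact_mod_cast congrArg (Nat.cast (R := ℚ_[S.Di i])) (S.D_eq_mul i)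
  rw [hD]
  push_cast
  have e : (S.Di i : ℚ_[S.Di i]) * (s + t) ^ 2 + (S.p + S.q) * (S.Di i * S.Dhat i) =
      S.Di i * (2 * s * t) := by linear_combination (S.Di i : ℚ_[S.Di i]) * (hs + ht)
  rw [e]
  linear_combination (-4 * (S.Di i : ℚ_[S.Di i]) ^ 2) * (t ^ 2 * hs - S.q * S.Dhat i * ht)

lemma Di_mem_selmerPhiSq (hm : 2 ≤ S.m) (i : Fin n) (h : S.PiD i = 0) :
    (S.DiUnit i : SqClass) ∈ S.selmerPhiSq (-1) := by
  have hpos := (S.Di_prime i).pos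
  refine S.mk_mem_selmerPhiSq (d := S.Di i) (by simp [DiUnit])
    (S.coverSolvable_real_of_pos (by omega)) (S.coverSolvable_two_Di hm i h)
    fun l hl hl2 hlb => ?_
  by_cases hli : l = S.Di i
  · subst hli
    exact S.coverSolvable_Di_Di hm i h
  have hnd : ¬l ∣ S.Di i := fun hd =>
    hli ((Nat.prime_dvd_prime_iff_eq hl.out (S.Di_prime i)).mp hd)
  rcases hlb with hlb | hlb
  · exact absurd (by exact_mod_cast hlb) hnd
  · refine S.coverSolvable_of_jacobiSym hl2 (by omega) (((S.PiD_eq_zero_iff i).mp h).2.2 l ?_)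
    rw [Nat.mem_primeFactors, S.D_eq_mul i] at hlb
    obtain ⟨-, hdvd, -⟩ := hlb
    refine Nat.mem_primeFactors.mpr ⟨hl.out, ?_, mul_ne_zero (mul_ne_zero S.p_prime.ne_zero
      S.q_prime.ne_zero) (S.Dhat_odd i).pos.ne'⟩
    have : l ∣ S.Di i * (S.p * S.q * S.Dhat i) := by convert hdvd using 1; ring
    exact (hl.out.dvd_mul.mp this).resolve_left hnd

end TwoDescent.Data
end
-- Independence of the classes and the count of dimensions
noncomputable section

/-- The additive subgroup spanned by a finite independent family of a `ZMod 2`-module. -/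
def LinearIndependent.closureEquiv {ι M : Type*} [Fintype ι] [AddCommGroup M] [Module (ZMod 2) M]
    {v : ι → M} (hv : LinearIndependent (ZMod 2) v) :
    AddSubgroup.closure (Set.range v) ≃+ (ι → ZMod 2) := by
  have h : AddSubgroup.closure (Set.range v) =
      (Submodule.span (ZMod 2) (Set.range v)).toAddSubgroup := by
    refine le_antisymm ((AddSubgroup.closure_le _).mpr Submodule.subset_span) fun x hx => ?_
    have : Submodule.span (ZMod 2) (Set.range v) ≤
        AddSubgroup.toZModSubmodule 2 (AddSubgroup.closure (Set.range v)) :=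
      Submodule.span_le.mpr AddSubgroup.subset_closure
    exact this hx
  exact (AddEquiv.addSubgroupCongr h).trans
    (hv.linearCombinationEquiv.symm.trans
      (Finsupp.linearEquivFunOnFinite (ZMod 2) (ZMod 2) ι)).toAddEquiv

/-- A subgroup is isomorphic to `Multiplicative A` if its additive version is isomorphic to `A`. -/
def Subgroup.equivOfToAddSubgroup {G A : Type*} [Group G] [AddGroup A] {H : Subgroup G}
    (e : Subgroup.toAddSubgroup H ≃+ A) : H ≃* Multiplicative A where
  toFun x := Multiplicative.ofAdd (e ⟨Additive.ofMul x.1, x.2⟩)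
  invFun a := ⟨(e.symm a.toAdd).1.toMul, (e.symm a.toAdd).2⟩
  left_inv x := by simp
  right_inv a := by simp
  map_mul' x y := by rw [← ofAdd_add, ← map_add]; rfl

namespace TwoDescent

namespace Data

open WeierstrassCurve
open scoped Classical

lemma sqClass_sq (x : SqClass) : x ^ 2 = 1 := by
  obtain ⟨d, rfl⟩ := QuotientGroup.mk_surjective x
  rw [← QuotientGroup.mk_pow, QuotientGroup.eq_one_iff]
  exact ⟨d, rfl⟩

instance (H : Subgroup SqClass) : Module (ZMod 2) (Additive H) :=
  AddCommGroup.zmodModule fun x => Subtype.ext (sqClass_sq x.toMul)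

instance : Module (ZMod 2) (Additive SqClass) :=
  AddCommGroup.zmodModule fun x => sqClass_sq x.toMul

/-- The linear form on `ℚ* / ℚ*²` induced by a character of `ℚ*` with values in `ℤ / 2`. -/
def sqChar (f : ℚˣ →* Multiplicative (ZMod 2)) : Additive SqClass →ₗ[ZMod 2] ZMod 2 :=
  AddMonoidHom.toZModLinearMap 2 (MonoidHom.toAdditiveLeft (QuotientGroup.lift _ f (by
    rintro _ ⟨d, rfl⟩
    rw [MonoidHom.mem_ker, powMonoidHom_apply, map_pow]
    generalize f d = z
    revert z
    decide)))

lemma sqChar_mk (f : ℚˣ →* Multiplicative (ZMod 2)) (t : ℚˣ) :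
    sqChar f (Additive.ofMul (t : SqClass)) = (f t).toAdd := rfl

/-- The sign character. -/
def signChar : ℚˣ →* Multiplicative (ZMod 2) :=
  MonoidHom.mk' (fun x => Multiplicative.ofAdd (if (x : ℚ) < 0 then 1 else 0)) fun x y => by
    rw [← ofAdd_add, Units.val_mul]
    congr 1
    have h2 : (1 + 1 : ZMod 2) = 0 := by decide
    rcases lt_or_gt_of_ne x.ne_zero with hx | hx <;> rcases lt_or_gt_of_ne y.ne_zero with hy | hy
    · simp [hx, hy, (mul_pos_of_neg_of_neg hx hy).le.not_gt, h2]
    · simp [hx, hy.le.not_gt, mul_neg_of_neg_of_pos hx hy]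
    · simp [hx.le.not_gt, hy, mul_neg_of_pos_of_neg hx hy]
    · simp [hx.le.not_gt, hy.le.not_gt, (mul_pos hx hy).le.not_gt]

/-- The `l`-adic valuation modulo `2`. -/
def valChar (l : ℕ) [Fact l.Prime] : ℚˣ →* Multiplicative (ZMod 2) :=
  MonoidHom.mk' (fun x => Multiplicative.ofAdd ((padicValRat l x : ℤ) : ZMod 2)) fun x y => by
    rw [← ofAdd_add, Units.val_mul, padicValRat.mul x.ne_zero y.ne_zero, Int.cast_add]

lemma toAdd_signChar (x : ℚˣ) : (signChar x).toAdd = if (x : ℚ) < 0 then 1 else 0 := rfl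

lemma toAdd_valChar (l : ℕ) [Fact l.Prime] (x : ℚˣ) :
    (valChar l x).toAdd = ((padicValRat l x : ℤ) : ZMod 2) := rfl

variable {n : ℕ} (S : Data n)

/-- The elements `-1`, `2`, `D₁, …, Dₙ` of `ℚ*`. -/
def gen : Option (Option (Fin n)) → ℚˣ
  | none => -1
  | some none => Units.mk0 2 two_ne_zero
  | some (some i) => S.DiUnit i

/-- The characters of `ℚ*` dual to `-1`, `2`, `D₁, …, Dₙ`. -/
def dualChar : Option (Option (Fin n)) → ℚˣ →* Multiplicative (ZMod 2)
  | none => signChar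
  | some none => valChar 2
  | some (some i) => haveI : Fact (S.Di i).Prime := ⟨S.Di_prime i⟩; valChar (S.Di i)

/-- The quantities `Π` attached to `-1`, `2`, `D₁, …, Dₙ`. -/
def PiGen : Option (Option (Fin n)) → ℤ
  | none => S.PiNegOne
  | some none => S.PiTwo
  | some (some i) => S.PiD i

lemma Di_ne_two (i : Fin n) : S.Di i ≠ 2 := fun h => by
  have := S.Di_odd i
  rw [h] at this
  exact absurd this (by decide)

lemma toAdd_dualChar_gen (j i : Option (Option (Fin n))) :
    (S.dualChar j (S.gen i)).toAdd = if i = j then 1 else 0 := by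
  rcases j with _ | _ | j
  · rw [dualChar, toAdd_signChar]
    rcases i with _ | _ | i
    · simp [gen]
    · exact if_neg (by norm_num [gen])
    · exact if_neg (by simp [gen, DiUnit])
  · rw [dualChar, toAdd_valChar]
    rcases i with _ | _ | i
    · simp [gen, padicValRat.neg]
    · have : padicValRat 2 (2 : ℚ) = 1 := by exact_mod_cast padicValRat.self one_lt_two
      simp [gen, this]
    · have : padicValNat 2 (S.Di i) = 0 := padicValNat.eq_zero_of_not_dvd fun h =>
        S.Di_ne_two i ((Nat.prime_dvd_prime_iff_eq Nat.prime_two (S.Di_prime i)).mp h).symm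
      simp [gen, DiUnit, this]
  · have hj : Fact (S.Di j).Prime := ⟨S.Di_prime j⟩
    rw [dualChar, toAdd_valChar]
    rcases i with _ | _ | i
    · simp [gen, padicValRat.neg]
    · have : padicValRat (S.Di j) (2 : ℚ) = 0 := by
        have h0 : padicValNat (S.Di j) 2 = 0 := padicValNat.eq_zero_of_not_dvd fun h =>
          S.Di_ne_two j ((Nat.prime_dvd_prime_iff_eq (S.Di_prime j) Nat.prime_two).mp h)
        rw [show (2 : ℚ) = ((2 : ℕ) : ℚ) by norm_num, padicValRat.of_nat, h0, Nat.cast_zero]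
      simp [gen, this]
    · by_cases hij : i = j
      · subst hij
        simp [gen, DiUnit, padicValNat_self]
      · have : padicValNat (S.Di j) (S.Di i) = 0 := padicValNat.eq_zero_of_not_dvd fun h =>
          hij (S.Di_inj ((Nat.prime_dvd_prime_iff_eq (S.Di_prime j) (S.Di_prime i)).mp h).symm)
        simp [gen, DiUnit, this, hij]

/-- The sign and the valuations at `2` and the `Dᵢ`, taken modulo 2, send the generators to the
standard basis. -/
lemma linearIndependent_gen :
    LinearIndependent (ZMod 2) fun i => Additive.ofMul (S.gen i : SqClass) := by
  refine LinearIndependent.of_comp (LinearMap.pi fun j => sqChar (S.dualChar j)) ?_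
  convert Pi.linearIndependent_single_one (Option (Option (Fin n))) (ZMod 2) using 1
  funext i j
  simp only [Function.comp_apply, LinearMap.pi_apply, sqChar_mk, toAdd_dualChar_gen,
    Pi.single_apply, eq_comm]
  rfl

lemma gen_mem_selmerPhiSq (hm : 2 ≤ S.m) (i : Option (Option (Fin n))) (h : S.PiGen i = 0) :
    (S.gen i : SqClass) ∈ S.selmerPhiSq (-1) := by
  rcases i with _ | _ | i
  · exact S.neg_one_mem_selmerPhiSq hm h
  · exact S.two_mem_selmerPhiSq h
  · exact S.Di_mem_selmerPhiSq hm i h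

lemma PiGen_nonneg (i : Option (Option (Fin n))) : 0 ≤ S.PiGen i := by
  have h (a : ℤ) (b : ℕ) : 0 ≤ 1 - jacobiSym a b := sub_nonneg.mpr (jacobiSym.le_one a b)
  rcases i with _ | _ | i
  · exact add_nonneg (by split_ifs <;> simp) (Finset.sum_nonneg fun l _ => h _ l)
  · exact add_nonneg (by split_ifs <;> simp) (Finset.sum_nonneg fun l _ => h _ l)
  · exact add_nonneg (add_nonneg (by split_ifs <;> simp) (mul_nonneg (h _ _) (h _ _)))
      (Finset.sum_nonneg fun l _ => h _ l)

lemma floor_one_div_one_add {z : ℤ} (hz : 0 ≤ z) :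
    ⌊(1 : ℚ) / (1 + z)⌋₊ = if z = 0 then 1 else 0 := by
  split_ifs with h
  · simp [h]
  · have h1 : (1 : ℚ) ≤ z := by exact_mod_cast (by omega : (1 : ℤ) ≤ z)
    rw [Nat.floor_eq_zero, div_lt_one (by linarith)]
    linarith

lemma card_PiGen_eq_zero : Fintype.card {i // S.PiGen i = 0} = S.rhoMinus := by
  have h := S.PiGen_nonneg
  simp only [Option.forall, PiGen] at h
  obtain ⟨h1, h2, h3⟩ := h
  rw [Fintype.card_subtype, Finset.card_filter, Fintype.sum_option, Fintype.sum_option, rhoMinus,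
    floor_one_div_one_add h1, floor_one_div_one_add h2,
    Finset.sum_congr rfl fun i _ => floor_one_div_one_add (h3 i)]
  exact (fun a b c : ℕ => by ring : ∀ a b c : ℕ, a + (b + c) = c + b + a) _ _ _

/-! ### Injectivity of the Kummer map -/

/-- Galois acts trivially on `E[φ]`, so coboundaries vanish. A trivial class therefore means that
every automorphism fixes `√d`, and `√d` is rational by Galois theory. -/
lemma kummer_injective (ε : ℤˣ) : Function.Injective (S.kummer ε) := by
  rw [injective_iff_map_eq_one]
  intro x hx
  obtain ⟨d, rfl⟩ := QuotientGroup.mk_surjective x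
  have h0 : H1.mk (S.kerPhi ε Qbar) ⟨S.kummerFun ε d, S.kummerFun_mem ε d⟩ = 0 := hx
  have h1 := (QuotientAddGroup.eq_zero_iff _).mp h0
  obtain ⟨P, hP, hPσ⟩ := AddSubgroup.mem_addSubgroupOf.mp h1
  have hfix : ∀ σ : GQ, σ (sqrtBar d) = sqrtBar d := fun σ => by
    have hz : S.kummerFun ε d σ = 0 := by
      have : S.kummerFun ε d σ = galAct (S.E ε) σ P - P := hPσ σ
      rw [this]
      rcases (S.mem_kerPhi ε Qbar).mp hP with rfl | rfl
      · simp
      · rw [galAct_T₀, sub_self]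
    by_contra hne
    simp only [kummerFun, hne, if_false] at hz
    exact absurd hz (by simp [T₀])
  obtain ⟨r, hr⟩ := (InfiniteGalois.mem_bot_iff_fixed (k := ℚ) (sqrtBar d)).mpr hfix
  have hrd : r ^ 2 = (d : ℚ) := by
    apply (algebraMap ℚ Qbar).injective
    rw [map_pow, ← sqrtBar_sq, ← hr]
    rfl
  have hr0 : r ≠ 0 := by
    rintro rfl
    exact d.ne_zero (by rw [← hrd, zero_pow two_ne_zero])
  rw [QuotientGroup.eq_one_iff]
  exact ⟨Units.mk0 r hr0, Units.ext hrd⟩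

/-- The Kummer map on the Selmer group, as a linear map. -/
def kummerSelmer (ε : ℤˣ) : Additive (S.selmerPhiSq ε) →ₗ[ZMod 2] S.selmerPhi ε :=
  AddMonoidHom.toZModLinearMap 2
    { toFun := fun x => ⟨(S.kummer ε x.toMul.1).toAdd, x.toMul.2⟩
      map_zero' := Subtype.ext (congrArg Multiplicative.toAdd (map_one (S.kummer ε)))
      map_add' := fun x y =>
        Subtype.ext (congrArg Multiplicative.toAdd (map_mul (S.kummer ε) x.toMul.1 y.toMul.1)) }

lemma kummerSelmer_injective (ε : ℤˣ) : Function.Injective (S.kummerSelmer ε) := fun _ _ h =>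
  Subtype.ext (S.kummer_injective ε (congrArg Subtype.val h))

end Data

end TwoDescent

end

theorem theoremA3 {n : ℕ} (S : TwoDescent.Data n) (hm : 2 ≤ S.m) :
    (∃ T : Finset ℚˣ,
      (T : Set ℚˣ) ⊆ {-1, Units.mk0 2 two_ne_zero} ∪ Set.range S.DiUnit ∧
      T.card = S.rhoMinus ∧
      Subgroup.closure ((fun t : ℚˣ => (t : TwoDescent.Data.SqClass)) '' (T : Set ℚˣ)) ≤
        S.selmerPhiSq (-1) ∧
      Nonempty (Subgroup.closure ((fun t : ℚˣ => (t : TwoDescent.Data.SqClass)) '' (T : Set ℚˣ)) ≃*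
        Multiplicative (Fin S.rhoMinus → ZMod 2))) ∧
    (S.rhoMinus : Cardinal) ≤ Module.rank (ZMod 2) (S.selmerPhi (-1)) := by
  classical
  let e : Fin S.rhoMinus ≃ {i // S.PiGen i = 0} :=
    (Fintype.equivFinOfCardEq S.card_PiGen_eq_zero).symm
  have hv : LinearIndependent (ZMod 2) fun k : Fin S.rhoMinus =>
      Additive.ofMul (S.gen (e k) : TwoDescent.Data.SqClass) :=
    S.linearIndependent_gen.comp (fun k => (e k).1) (Subtype.val_injective.comp e.injective)
  have hinj : Function.Injective fun k : Fin S.rhoMinus => S.gen (e k) := fun k k' h =>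
    hv.injective (congrArg (fun t : ℚˣ => Additive.ofMul (t : TwoDescent.Data.SqClass)) h)
  have hmem : ∀ k, (S.gen (e k) : TwoDescent.Data.SqClass) ∈ S.selmerPhiSq (-1) := fun k =>
    S.gen_mem_selmerPhiSq hm _ (e k).2
  refine ⟨⟨Finset.univ.image fun k => S.gen (e k), ?_, ?_, ?_, ?_⟩, ?_⟩
  · intro t ht
    obtain ⟨k, -, rfl⟩ := Finset.mem_image.mp (Finset.mem_coe.mp ht)
    rcases (e k).1 with _ | _ | i
    · exact Or.inl (Or.inl rfl)
    · exact Or.inl (Or.inr rfl)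
    · exact Or.inr ⟨i, rfl⟩
  · rw [Finset.card_image_of_injective _ hinj, Finset.card_univ, Fintype.card_fin]
  · rw [Subgroup.closure_le]
    rintro _ ⟨t, ht, rfl⟩
    obtain ⟨k, -, rfl⟩ := Finset.mem_image.mp (Finset.mem_coe.mp ht)
    exact hmem k
  · refine ⟨Subgroup.equivOfToAddSubgroup ((AddEquiv.addSubgroupCongr ?_).trans hv.closureEquiv)⟩
    rw [Subgroup.toAddSubgroup_closure]
    congr 1
    ext x
    simp only [Finset.coe_image, Finset.coe_univ, Set.image_univ, Set.mem_preimage,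
      ← Set.range_comp, Set.mem_range, Function.comp_apply]
    rfl
  -- Independence is pulled back to the Selmer subgroup of `ℚ*/ℚ*²`, then carried into `H¹(ℚ, E[φ])`
  -- by the injective Kummer map.
  · have hw : LinearIndependent (ZMod 2) fun k : Fin S.rhoMinus =>
        (Additive.ofMul ⟨_, hmem k⟩ : Additive (S.selmerPhiSq (-1))) :=
      LinearIndependent.of_comp (AddMonoidHom.toZModLinearMap 2
        (MonoidHom.toAdditive (S.selmerPhiSq (-1)).subtype)) hv
    have := (hw.map' (S.kummerSelmer (-1))
      (LinearMap.ker_eq_bot.mpr (S.kummerSelmer_injective (-1)))).cardinal_le_rank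
    simpa using this
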